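/- Let $k$ be a field of characteristic $0$ and $m,n\ge 0$. All algebras are graded by $\mathbb Z\times\mathbb Z$, the degree $|a|=(p(a),w(a))$ consisting of the parity and the weight; put $|a||b|:=p(a)p(b)+w(a)w(b)$, and let $\mathrm{Sym}\{\dots\}$ be the free algebra on the given generators subject to $ab=(-1)^{|a||b|}ba$. Let $$A=\mathcal O(k^{m||n})=\mathrm{Sym}\{x_1,\dots,x_m,y_1,\dots,y_n\},\quad |x_i|=(0,0),\ |y_j|=(1,0),$$ $$A^!=\mathcal O(k^{n\wedge m})=\mathrm{Sym}\{\xi_1,\dots,\xi_m,\eta_1,\dots,\eta_n\},\quad |\xi_i|=(0,-1),\ |\eta_j|=(-1,-1).$$ Write $z_1,\dots,z_{m+n}$ for the generators of $A$ and $\zeta_1,\dots,\zeta_{m+n}$ for the corresponding generators of $A^!$. *Polyvectors.* For $\mathcal A=\mathrm{Sym}\{z_i\}$ let $\mathfrak X^\bullet(\mathcal A)=\mathrm{Sym}\{z_i,\partial_{z_i}\}$ with $|\partial_z|=-|z|+(0,-1)$. The Schouten–Nijenhuis bracket is the bilinear bracket with $[\partial_{z_i},z_j]=\delta_{ij}$,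 $[z_i,z_j]=[\partial_{z_i},\partial_{z_j}]=0$, $[P,Q]=-(-1)^{(|P|-|s|)(|Q|-|s|)}[Q,P]$ and $[P,QS]=[P,Q]S+(-1)^{|Q|(|P|-|s|)}Q[P,S]$, where $|s|=(0,-1)$. A bivector $\pi$ is Poisson if $[\pi,\pi]=0$; then $\mathrm{HP}^{s,t}(\mathcal A)$ is the part of degree $(-s,-t)$ of the cohomology of $\mathfrak X^\bullet(\mathcal A)$ with respect to $\delta^\pi=[-,\pi]$. *Koszul dual.* Let $\pi=\sum C^{ij}_{ab}\,z_iz_j\,\partial_{z_a}\wedge\partial_{z_b}$ be a quadratic Poisson structure on $k^{m||n}$ of degree $(0,-2)$, that is, a linear combination of terms $x_ix_j\partial_{x_a}\wedge\partial_{x_b}$, $y_uy_v\partial_{y_s}\wedge\partial_{y_t}$, $x_iy_s\partial_{x_a}\wedge\partial_{y_t}$. Its Koszul dual on $k^{n\wedge m}$ is $\pi^!=\sum C^{ij}_{ab}\,\zeta_a\zeta_b\,\partial_{\zeta_i}\wedge\partial_{\zeta_j}$. *Mixed forms.* $\tilde\Omega^\bullet(\mathcal A)$ is $\mathrm{Sym}$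 on the generators $z,dz$ for every coordinate $z$ with $p(z)+w(z)$ even and $\partial_z,z^*$ for every coordinate $z$ with $p(z)+w(z)$ odd, with $|dz|=|z|+(0,1)$ and $|z^*|=|\partial_z|+(0,1)=-|z|$; $\tilde d$ is the derivation of degree $(0,1)$ with $z\mapsto dz\mapsto 0$ and $\partial_z\mapsto z^*\mapsto 0$ respectively. The contraction $\tilde\iota$ is the algebra map from $\mathfrak X^\bullet(\mathcal A)$ to the linear endomorphisms of $\tilde\Omega^\bullet(\mathcal A)$ in which $z$ ($z$ even) and $\partial_z$ ($z$ odd) act by left multiplication, while $\partial_z$ ($z$ even) and $z$ ($z$ odd) act by the derivations of the same degree that vanish on all generators except $\tilde\iota_{\partial_z}(dz)=1$ and $\tilde\iota_z(z^*)=(-1)^{w(z)}$. Put $\partial_\pi=[\tilde\iota_\pi,\tilde d]=\tilde\iota_\pi\tilde d-\tilde d\,\tilde\iota_\pi$, with homology $\widetilde{\mathrm{HP}}$. A mixed volume form is an element $\gamma\in\tilde\Omega^\bullet(\mathcal A)$ of degree $(-n,m)$ such that, for all $i,j$, $P\mapsto\tilde\iota_P\gamma$ is bijective from the polyvectors of degree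 $(-i,-j)$ to the mixed forms of degree $(-n-i,m-j)$. The Poisson structure is unimodular if some mixed volume form satisfies $\partial_\pi\gamma=0$. The standard mixed volume forms are $$\gamma=dx_1\wedge\dots\wedge dx_m\wedge y_1^*\wedge\dots\wedge y_n^*,\qquad \gamma^!=\xi_1^*\wedge\dots\wedge\xi_m^*\wedge d\eta_1\wedge\dots\wedge d\eta_n .$$ **Theorem.** The bivector $\pi^!$ is Poisson, and: (1) $\pi$ is unimodular if and only if $\pi^!$ is unimodular. (2) In that case $\mathrm{PD}:[P]\mapsto[\tilde\iota_P\gamma]$ is a well-defined isomorphism $\mathrm{HP}(A)\to\widetilde{\mathrm{HP}}(A)$, and $\mathrm{HP}^{\bullet,\bullet}(A)$, with the product induced by the wedge product and $\Delta=-\mathrm{PD}^{-1}\circ\tilde d\circ\mathrm{PD}$, is a Batalin–Vilkovisky algebra: a bi-graded commutative associative unital algebra with an operator $\Delta$ of degree $(0,1)$ such that $\Delta^2=0$ and $$\begin{aligned}\Delta(abc)={}&\Delta(ab)c+(-1)^{|a||\Delta|}a\Delta(bc)+(-1)^{|b|(|a|+|\Delta|)}b\Delta(ac)\\&-\Delta(a)bc-(-1)^{|a||\Delta|}a\Delta(b)c-(-1)^{|\Delta|(|a|+|b|)}ab\Delta(c).\end{aligned}$$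 Moreover $\Delta$ generates the bracket induced by the Schouten–Nijenhuis bracket: $[a,b]=(-1)^{w(a)}\Delta(ab)-(-1)^{w(a)}\Delta(a)b-a\Delta(b)$. The same holds for $A^!$, $\pi^!$, $\gamma^!$. The algebra map $\mathfrak X^\bullet(A)\to\mathfrak X^\bullet(A^!)$ with $x_i\mapsto\partial_{\xi_i}$, $y_j\mapsto\partial_{\eta_j}$, $\partial_{x_i}\mapsto-\xi_i$, $\partial_{y_j}\mapsto\eta_j$ induces an isomorphism $\mathrm{HP}^{\bullet,\bullet}(A)\cong\mathrm{HP}^{\bullet,\bullet}(A^!)$ of Batalin–Vilkovisky algebras. -/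

import Mathlib

noncomputable section

namespace Bigraded

/-! ### Bidegrees and the sign rule -/

/-- A bidegree `(parity, weight)`. -/
abbrev Bideg := ℤ × ℤ

/-- The sign `(-1)^{p(a)p(b) + w(a)w(b)}`. -/
def csign (k : Type*) [Field k] (a b : Bideg) : k := (-1 : k) ^ (a.1 * b.1 + a.2 * b.2)

section Signs
variable (k : Type*) [Field k]

theorem csign_add_left (a b c : Bideg) : csign k (a + b) c = csign k a c * csign k b c := by
  unfold csign
  rw [← zpow_add₀ (by norm_num)]
  congr 1
  simp only [Prod.fst_add, Prod.snd_add]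
  ring

theorem csign_comm (a b : Bideg) : csign k a b = csign k b a := by
  unfold csign
  congr 1
  ring

theorem csign_add_right (a b c : Bideg) : csign k a (b + c) = csign k a b * csign k a c := by
  rw [csign_comm, csign_add_left, csign_comm k b, csign_comm k c]

theorem csign_neg_right (a b : Bideg) : csign k a (-b) = csign k a b := by
  unfold csign
  have h : a.1 * (-b).1 + a.2 * (-b).2 = -(a.1 * b.1 + a.2 * b.2) := by
    simp only [Prod.fst_neg, Prod.snd_neg]
    ring
  rw [h, zpow_neg, ← inv_zpow]
  norm_num

theorem csign_neg_left (a b : Bideg) : csign k (-a) b = csign k a b := by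
  rw [csign_comm, csign_neg_right, csign_comm]

theorem csign_sq (a b : Bideg) : csign k a b * csign k a b = 1 := by
  unfold csign
  rw [← mul_zpow]
  norm_num

theorem csign_zero_left (b : Bideg) : csign k 0 b = 1 := by
  simp [csign]

end Signs

/-! ### Free bi-graded commutative algebras -/

section FreeSym
variable (k : Type*) [Field k] {G : Type*} (deg : G → Bideg)

/-- The relations `g h = (-1)^{p(g)p(h) + w(g)w(h)} h g` between the generators. -/
inductive SymRel : FreeAlgebra k G → FreeAlgebra k G → Prop
  | swap (g h : G) : SymRel (FreeAlgebra.ι k g * FreeAlgebra.ι k h)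
      (csign k (deg g) (deg h) • (FreeAlgebra.ι k h * FreeAlgebra.ι k g))

/-- `Sym{g : g ∈ G}`: the free bi-graded commutative `k`-algebra on the generators `g : G` of
bidegree `deg g`. -/
def BSym : Type _ := RingQuot (SymRel k deg)

instance : Ring (BSym k deg) := inferInstanceAs (Ring (RingQuot (SymRel k deg)))

instance : Algebra k (BSym k deg) := inferInstanceAs (Algebra k (RingQuot (SymRel k deg)))

namespace BSym

/-- The quotient map from the free algebra. -/
def mk : FreeAlgebra k G →ₐ[k] BSym k deg := RingQuot.mkAlgHom k (SymRel k deg)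

theorem mk_surjective : Function.Surjective (mk k deg) :=
  RingQuot.mkAlgHom_surjective k (SymRel k deg)

/-- The generator `g` of `BSym`. -/
def gen (g : G) : BSym k deg := mk k deg (FreeAlgebra.ι k g)

theorem gen_mul_gen (g h : G) :
    gen k deg g * gen k deg h = csign k (deg g) (deg h) • (gen k deg h * gen k deg g) := by
  unfold gen
  have h := RingQuot.mkAlgHom_rel k (SymRel.swap (k := k) (deg := deg) g h)
  rw [← map_mul, ← map_mul, ← map_smul]
  exact h

/-- The homogeneous component of bidegree `d`: the span of the words of bidegree `d`. -/
def comp (d : Bideg) : Submodule k (BSym k deg) :=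
  Submodule.span k {x | ∃ l : List G, (l.map deg).sum = d ∧ x = (l.map (gen k deg)).prod}

variable {k deg}

/-- The algebra map out of `BSym` with prescribed (sign-commuting) values on the generators. -/
def lift {B : Type*} [Ring B] [Algebra k B] (f : G → B)
    (hf : ∀ g h, f g * f h = csign k (deg g) (deg h) • (f h * f g)) : BSym k deg →ₐ[k] B :=
  RingQuot.liftAlgHom k ⟨FreeAlgebra.lift k f, by
    rintro _ _ ⟨g, h⟩
    simpa using hf g h⟩

@[simp] theorem lift_gen {B : Type*} [Ring B] [Algebra k B] (f : G → B)
    (hf : ∀ g h, f g * f h = csign k (deg g) (deg h) • (f h * f g)) (g : G) :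
    lift f hf (gen k deg g) = f g := by
  have h := RingQuot.liftAlgHom_mkAlgHom_apply k (FreeAlgebra.lift k f) (s := SymRel k deg) (by
    rintro _ _ ⟨g, h⟩
    simpa using hf g h) (FreeAlgebra.ι k g)
  rw [FreeAlgebra.lift_ι_apply] at h
  exact h

theorem induction {P : BSym k deg → Prop} (one : P 1) (add : ∀ x y, P x → P y → P (x + y))
    (smul : ∀ (c : k) x, P x → P (c • x)) (mul : ∀ g x, P x → P (gen k deg g * x))
    (x : BSym k deg) : P x := by
  obtain ⟨a, rfl⟩ := mk_surjective k deg x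
  have key : ∀ y, P y → P (mk k deg a * y) := by
    induction a using FreeAlgebra.induction with
    | grade0 r =>
      intro y hy
      rw [AlgHom.commutes, ← Algebra.smul_def]
      exact smul r y hy
    | grade1 g => exact fun y hy => mul g y hy
    | mul a b ha hb =>
      intro y hy
      rw [map_mul, mul_assoc]
      exact ha _ (hb y hy)
    | add a b ha hb =>
      intro y hy
      rw [map_add, add_mul]
      exact add _ _ (ha y hy) (hb y hy)
  simpa using key 1 one

theorem one_mem_comp : (1 : BSym k deg) ∈ comp k deg 0 :=
  Submodule.subset_span ⟨[], by simp, by simp⟩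

theorem gen_mem_comp (g : G) : gen k deg g ∈ comp k deg (deg g) :=
  Submodule.subset_span ⟨[g], by simp, by simp⟩

theorem comp_mul_gen {d : Bideg} {x : BSym k deg} (hx : x ∈ comp k deg d) (h : G) :
    x * gen k deg h = csign k d (deg h) • (gen k deg h * x) := by
  induction hx using Submodule.span_induction with
  | mem x hx =>
    obtain ⟨l, hl, rfl⟩ := hx
    induction l generalizing d with
    | nil =>
      simp only [List.map_nil, List.sum_nil] at hl
      subst hl
      simp [csign_zero_left]
    | cons g l ih =>
      simp only [List.map_cons, List.sum_cons, List.prod_cons] at hl ⊢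
      subst hl
      rw [mul_assoc, ih rfl, mul_smul_comm, ← mul_assoc, gen_mul_gen, smul_mul_assoc, smul_smul,
        mul_assoc, csign_add_left, mul_comm]
  | zero => simp
  | add x y _ _ hx hy => rw [add_mul, mul_add, hx, hy, smul_add]
  | smul c x _ hx => rw [smul_mul_assoc, mul_smul_comm, hx, smul_comm]

/-- The automorphism of `BSym` that multiplies a homogeneous `x` by `(-1)^{p(e)p(x) + w(e)w(x)}`. -/
def twist (e : Bideg) : BSym k deg →ₐ[k] BSym k deg :=
  lift (fun g => csign k e (deg g) • gen k deg g) (by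
    intro g h
    rw [smul_mul_smul_comm, smul_mul_smul_comm, gen_mul_gen, smul_smul, smul_smul]
    congr 1
    ring)

/-- Auxiliary upper triangular representation that encodes a derivation. -/
def derHom (e : Bideg) (v : G → BSym k deg) (hv : ∀ g, v g ∈ comp k deg (e + deg g)) :
    BSym k deg →ₐ[k] Matrix (Fin 2) (Fin 2) (BSym k deg) :=
  lift (fun g => !![csign k e (deg g) • gen k deg g, v g; 0, gen k deg g]) (by
    intro g h
    have h1 := gen_mul_gen k deg g h
    have h2 : v g * gen k deg h = (csign k e (deg h) * csign k (deg g) (deg h)) •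
        (gen k deg h * v g) := by rw [comp_mul_gen (hv g) h, csign_add_left]
    have h3 : v h * gen k deg g = (csign k e (deg g) * csign k (deg g) (deg h)) •
        (gen k deg g * v h) := by
      rw [comp_mul_gen (hv h) g, csign_add_left, csign_comm k (deg h)]
    have h4 := csign_sq k (deg g) (deg h)
    ext i j
    fin_cases i <;> fin_cases j
    · simp [Matrix.mul_apply, Fin.sum_univ_two, h1, smul_smul, mul_comm, mul_left_comm]
    · simp only [Fin.zero_eta, Fin.mk_one, Matrix.mul_apply, Fin.sum_univ_two, Matrix.smul_apply,
        Matrix.of_apply, Matrix.cons_val', Matrix.cons_val_zero, Matrix.cons_val_one,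
        Matrix.cons_val_fin_one, smul_mul_assoc, h2, h3, smul_add, smul_smul]
      rw [add_comm]
      congr 1
      · rw [mul_comm]
      · rw [mul_left_comm, h4, mul_one]
    · simp [Matrix.mul_apply, Fin.sum_univ_two]
    · simp [Matrix.mul_apply, Fin.sum_univ_two, h1])

/-- The (bi-graded) derivation `D` of bidegree `e` with `D g = v g` on the generators; it satisfies
`D (x y) = D x * y + (-1)^{p(e)p(x) + w(e)w(x)} x * D y`. -/
def der (e : Bideg) (v : G → BSym k deg) (hv : ∀ g, v g ∈ comp k deg (e + deg g)) :
    BSym k deg →ₗ[k] BSym k deg :=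
  (Matrix.entryLinearMap k (BSym k deg) (0 : Fin 2) (1 : Fin 2)) ∘ₗ (derHom e v hv).toLinearMap

theorem der_gen (e : Bideg) (v : G → BSym k deg) (hv : ∀ g, v g ∈ comp k deg (e + deg g)) (g : G) :
    der e v hv (gen k deg g) = v g := by
  simp [der, derHom]

theorem derHom_diag (e : Bideg) (v : G → BSym k deg) (hv : ∀ g, v g ∈ comp k deg (e + deg g))
    (x : BSym k deg) : derHom e v hv x 0 0 = twist e x ∧ derHom e v hv x 1 0 = 0 ∧
      derHom e v hv x 1 1 = x := by
  induction x using BSym.induction with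
  | one => simp
  | add x y hx hy => simp [hx, hy]
  | smul c x hx => simp [hx]
  | mul g x hx =>
    have h1 : derHom e v hv (gen k deg g) =
        !![csign k e (deg g) • gen k deg g, v g; 0, gen k deg g] := lift_gen _ _ g
    have h2 : twist e (gen k deg g) = csign k e (deg g) • gen k deg g := lift_gen _ _ g
    simp [Matrix.mul_apply, Fin.sum_univ_two, hx, h1, h2]

theorem der_mul (e : Bideg) (v : G → BSym k deg) (hv : ∀ g, v g ∈ comp k deg (e + deg g))
    (x y : BSym k deg) :
    der e v hv (x * y) = der e v hv x * y + twist e x * der e v hv y := by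
  have hx := derHom_diag e v hv x
  have hy := derHom_diag e v hv y
  simp [der, Matrix.mul_apply, Fin.sum_univ_two, hx, hy, add_comm]

theorem der_one (e : Bideg) (v : G → BSym k deg) (hv : ∀ g, v g ∈ comp k deg (e + deg g)) :
    der e v hv 1 = 0 := by
  simp [der]


/-- The left partial derivative with respect to the generator `g`: the derivation of bidegree
`-deg g` with `∂_g g = 1` and `∂_g h = 0` for the other generators `h`. -/
def partialD [DecidableEq G] (g : G) : BSym k deg →ₗ[k] BSym k deg :=
  der (-deg g) (fun h => if h = g then 1 else 0) (by
    intro h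
    split_ifs with hh
    · subst hh
      rw [neg_add_cancel]
      exact one_mem_comp
    · exact Submodule.zero_mem _)

/-- The right partial derivative with respect to the generator `g`; for homogeneous `x` it equals
`(-1)^{|g|(|x|-|g|)} ∂_g x`. -/
def rightD [DecidableEq G] (g : G) : BSym k deg →ₗ[k] BSym k deg :=
  csign k (deg g) (deg g) • (partialD g ∘ₗ (twist (deg g)).toLinearMap)

theorem partialD_gen_mul [DecidableEq G] (g h : G) (x : BSym k deg) :
    partialD g (gen k deg h * x) = (if h = g then x else 0) +
      csign k (deg g) (deg h) • (gen k deg h * partialD g x) := by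
  unfold partialD
  rw [der_mul, der_gen]
  have h2 : twist (-deg g) (gen k deg h) = csign k (-deg g) (deg h) • gen k deg h :=
    lift_gen _ _ h
  rw [h2, csign_neg_left, smul_mul_assoc]
  split_ifs <;> simp

theorem partialD_one [DecidableEq G] (g : G) : partialD g (1 : BSym k deg) = 0 :=
  der_one _ _ _

theorem partialD_comm [DecidableEq G] (g h : G) (x : BSym k deg) :
    partialD g (partialD h x) = csign k (deg g) (deg h) • partialD h (partialD g x) := by
  induction x using BSym.induction with
  | one => simp [partialD_one]
  | add x y hx hy => simp only [map_add, hx, hy, smul_add]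
  | smul c x hx => simp only [map_smul, hx, smul_comm c]
  | mul a x hx =>
    rw [partialD_gen_mul, partialD_gen_mul, map_add, map_add, map_smul, map_smul,
      partialD_gen_mul, partialD_gen_mul, hx]
    by_cases h1 : a = g
    · by_cases h2 : a = h
      · subst h1
        subst h2
        have := csign_sq k (deg a) (deg a)
        simp only [if_true, smul_add, smul_smul, mul_smul_comm, this, one_smul]
        abel
      · subst h1
        simp only [if_true, if_neg h2, map_zero, zero_add, smul_add, smul_smul, mul_smul_comm,
          csign_comm k (deg h) (deg a)]
    · by_cases h2 : a = h
      · subst h2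
        have := csign_sq k (deg g) (deg a)
        simp only [if_true, if_neg h1, map_zero, zero_add, smul_add, smul_smul, mul_smul_comm]
        rw [this, mul_one, ← mul_assoc, this, one_mul, one_smul]
      · simp only [if_neg h1, if_neg h2, map_zero, zero_add, smul_smul, mul_smul_comm]
        congr 1
        ring

end BSym
end FreeSym

/-! ### Polyvectors -/

section Poisson
variable (k : Type*) [Field k] {Z : Type*} (deg : Z → Bideg)

/-- Bidegrees of the coordinates `z` (`Sum.inl z`) and of the `∂_z` (`Sum.inr z`). -/
def polyDeg : Z ⊕ Z → Bideg :=
  Sum.elim deg (fun z => -deg z + (0, -1))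

/-- The polyvectors `𝔛^•(A) = Sym{z, ∂_z : z ∈ Z}` on the bi-graded space with coordinates `Z` of
bidegrees `deg`, that is, on the algebra `A = Sym{z : z ∈ Z}`. -/
abbrev Polyvector : Type _ := BSym k (polyDeg deg)

/-- The coordinate function `z`. -/
def coord (z : Z) : Polyvector k deg := BSym.gen k (polyDeg deg) (Sum.inl z)

/-- The coordinate vector field `∂_z`. -/
def vect (z : Z) : Polyvector k deg := BSym.gen k (polyDeg deg) (Sum.inr z)

/-- The quadratic bivector `∑ C i j a b • z_i z_j ∂_a ∧ ∂_b`. -/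
def quadBivector [Fintype Z] (C : Z → Z → Z → Z → k) : Polyvector k deg :=
  ∑ i, ∑ j, ∑ a, ∑ b,
    C i j a b • (coord k deg i * coord k deg j * vect k deg a * vect k deg b)

variable {k deg} [Fintype Z] [DecidableEq Z]

/-- The bi-graded Schouten-Nijenhuis bracket
`[P, Q] = ∑_z (P ←∂/∂(∂_z)) (∂Q/∂z) - (-1)^{p(z)} (P ←∂/∂z) (∂Q/∂(∂_z))`.
It is the unique bilinear bracket with `[∂_z, z'] = δ`, `[z, z'] = 0`, `[∂_z, ∂_z'] = 0`,
`[P, Q] = -(-1)^{(|P|-|s|)(|Q|-|s|)} [Q, P]` and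
`[P, Q ∧ S] = [P, Q] ∧ S + (-1)^{|Q|(|P|-|s|)} Q ∧ [P, S]`, where `|s| = (0, -1)`. -/
def bracket : Polyvector k deg →ₗ[k] Polyvector k deg →ₗ[k] Polyvector k deg :=
  ∑ z : Z, ((LinearMap.mul k (Polyvector k deg)).compl₁₂
      (BSym.rightD (Sum.inr z)) (BSym.partialD (Sum.inl z))
    - (-1 : k) ^ (deg z).1 • (LinearMap.mul k (Polyvector k deg)).compl₁₂
      (BSym.rightD (Sum.inl z)) (BSym.partialD (Sum.inr z)))

/-- A bivector `π` is Poisson if `[π, π] = 0`. -/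
def IsPoisson (π : Polyvector k deg) : Prop := bracket π π = 0

/-- The Poisson coboundary map `δ^π = [-, π]`. -/
def cobdry (π : Polyvector k deg) : Polyvector k deg →ₗ[k] Polyvector k deg := bracket.flip π


end Poisson

/-! ### Mixed differential forms -/

section Mixed
variable {k : Type*} [Field k] {Z : Type*} [DecidableEq Z] {deg : Z → Bideg}

/-- The bidegree of the function-like generator attached to `z`: this generator is `z` itself if
`p(z) + w(z)` is even, and `∂_z` if `p(z) + w(z)` is odd. -/
def baseDeg (deg : Z → Bideg) (z : Z) : Bideg :=
  if Even ((deg z).1 + (deg z).2) then deg z else -deg z + (0, -1)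

/-- Bidegrees of the generators of the mixed differential forms. -/
def mixDeg (deg : Z → Bideg) : Z ⊕ Z → Bideg :=
  Sum.elim (baseDeg deg) (fun z => baseDeg deg z + (0, 1))

variable (k deg) in
/-- The mixed differential forms `Ω̃^•(A)`: for a coordinate `z` with `p(z) + w(z)` even the
generators are `z` (`Sum.inl z`) and `dz` (`Sum.inr z`); for `p(z) + w(z)` odd they are `∂_z`
(`Sum.inl z`) and `z^*` (`Sum.inr z`). -/
abbrev MixedForm : Type _ := BSym k (mixDeg deg)

/-- The differential `d̃`: the derivation of bidegree `(0, 1)` with `z ↦ dz ↦ 0` in the even case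
and `∂_z ↦ z^* ↦ 0` in the odd case. -/
def mixD : MixedForm k deg →ₗ[k] MixedForm k deg :=
  BSym.der (0, 1) (Sum.elim (fun z => BSym.gen k (mixDeg deg) (Sum.inr z)) (fun _ => 0)) (by
    rintro (z | z)
    · have h := BSym.gen_mem_comp (k := k) (deg := mixDeg deg) (Sum.inr z)
      have e : mixDeg deg (Sum.inr z) = (0, 1) + mixDeg deg (Sum.inl z) := add_comm _ _
      rwa [e] at h
    · exact Submodule.zero_mem _)

/-- The mixed contraction by a generator of the polyvectors. For `z` even, `z` acts by left
multiplication and `∂_z` by the contraction with `⟨dz, ∂_z⟩ = 1`. For `z` odd, `∂_z` acts by left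
multiplication and `z` by the contraction with `⟨z^*, z⟩ = (-1)^{w(z)}`; this value of the pairing
is the one for which `[[ι_P, d̃], ι_Q] = ι_{[P, Q]}` holds. -/
def contrGen : Z ⊕ Z → Module.End k (MixedForm k deg)
  | Sum.inl z =>
    if Even ((deg z).1 + (deg z).2) then
      LinearMap.mulLeft k (BSym.gen k (mixDeg deg) (Sum.inl z))
    else (-1 : k) ^ (deg z).2 • BSym.partialD (Sum.inr z)
  | Sum.inr z =>
    if Even ((deg z).1 + (deg z).2) then BSym.partialD (Sum.inr z)
    else LinearMap.mulLeft k (BSym.gen k (mixDeg deg) (Sum.inl z))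

theorem contrGen_cases (g : Z ⊕ Z) :
    (∃ z, contrGen (k := k) (deg := deg) g =
        LinearMap.mulLeft k (BSym.gen k (mixDeg deg) (Sum.inl z)) ∧
      polyDeg deg g = mixDeg deg (Sum.inl z)) ∨
    (∃ (z : Z) (c : k), contrGen (k := k) (deg := deg) g = c • BSym.partialD (Sum.inr z) ∧
      polyDeg deg g = -mixDeg deg (Sum.inr z)) := by
  rcases g with z | z <;> by_cases h : Even ((deg z).1 + (deg z).2)
  · exact Or.inl ⟨z, by simp [contrGen, h], by simp [polyDeg, mixDeg, baseDeg, h]⟩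
  · refine Or.inr ⟨z, (-1 : k) ^ (deg z).2, by simp [contrGen, h], ?_⟩
    ext <;> simp [polyDeg, mixDeg, baseDeg, h, add_comm]
  · refine Or.inr ⟨z, 1, by simp [contrGen, h], ?_⟩
    ext <;> simp [polyDeg, mixDeg, baseDeg, h, add_comm]
  · exact Or.inl ⟨z, by simp [contrGen, h], by simp [polyDeg, mixDeg, baseDeg, h]⟩

/-- The mixed contraction `P ↦ ι̃_P`, with `ι̃_{P ∧ Q} = ι̃_P ∘ ι̃_Q`. -/
def contr : Polyvector k deg →ₐ[k] Module.End k (MixedForm k deg) :=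
  BSym.lift contrGen (by
    intro g h
    rcases contrGen_cases (k := k) (deg := deg) g with ⟨y, e1, d1⟩ | ⟨y, c, e1, d1⟩ <;>
    rcases contrGen_cases (k := k) (deg := deg) h with ⟨z, e2, d2⟩ | ⟨z, c', e2, d2⟩ <;>
    rw [e1, e2, d1, d2] <;> ext x
    · simp only [Module.End.mul_apply, LinearMap.mulLeft_apply, LinearMap.smul_apply]
      rw [← mul_assoc, BSym.gen_mul_gen, smul_mul_assoc, mul_assoc]
    · simp only [Module.End.mul_apply, LinearMap.mulLeft_apply, LinearMap.smul_apply,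
        BSym.partialD_gen_mul, reduceCtorEq, if_false, zero_add, csign_neg_right]
      rw [csign_comm, smul_comm c', smul_smul, csign_sq, one_smul, mul_smul_comm]
    · simp only [Module.End.mul_apply, LinearMap.mulLeft_apply, LinearMap.smul_apply,
        BSym.partialD_gen_mul, reduceCtorEq, if_false, zero_add, csign_neg_left]
      rw [mul_smul_comm, smul_comm c]
    · simp only [Module.End.mul_apply, LinearMap.smul_apply, map_smul, csign_neg_left,
        csign_neg_right]
      rw [BSym.partialD_comm, smul_comm c c', smul_comm c (csign k _ _),
        smul_comm c' (csign k _ _)])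

/-- The Poisson boundary map `∂_π = [ι̃_π, d̃]` (`π` has bidegree `(0, -2)`). -/
def bdry (π : Polyvector k deg) : MixedForm k deg →ₗ[k] MixedForm k deg :=
  contr π ∘ₗ mixD - mixD ∘ₗ contr π

end Mixed

/-! ### Cohomology -/

section Cohomology
variable {k : Type*} [Field k] {V W : Type*} [AddCommGroup V] [Module k V]
  [AddCommGroup W] [Module k W]

/-- The cohomology `ker D / im D` of an endomorphism `D` with `D² = 0`. -/
abbrev Coh (D : V →ₗ[k] V) : Type _ :=
  LinearMap.ker D ⧸ (LinearMap.range D).submoduleOf (LinearMap.ker D)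

/-- The class of a cocycle. -/
def cls (D : V →ₗ[k] V) (a : LinearMap.ker D) : Coh D := Submodule.Quotient.mk a

/-- The subspace of the classes that have a representing cocycle in `S`. -/
def Coh.part (D : V →ₗ[k] V) (S : Submodule k V) : Submodule k (Coh D) :=
  (S.submoduleOf (LinearMap.ker D)).map
    ((LinearMap.range D).submoduleOf (LinearMap.ker D)).mkQ

/-- `f` maps cocycles to cocycles and `F [a] = [f a]` for every cocycle `a`. -/
def Induces (D : V →ₗ[k] V) (D' : W →ₗ[k] W) (f : V → W) (F : Coh D → Coh D') : Prop :=
  ∀ a : LinearMap.ker D, ∃ b : LinearMap.ker D', (b : W) = f a ∧ F (cls D a) = cls D' b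

/-- `f` maps pairs of cocycles to cocycles and `F [a] [b] = [f a b]` for all cocycles `a, b`. -/
def Induces₂ (D : V →ₗ[k] V) (f : V → V → V) (F : Coh D → Coh D → Coh D) : Prop :=
  ∀ a b : LinearMap.ker D, ∃ c : LinearMap.ker D,
    (c : V) = f a b ∧ F (cls D a) (cls D b) = cls D c

end Cohomology

/-! ### Batalin-Vilkovisky algebras -/

section BV
variable (k : Type*) [Field k]

/-- A Batalin-Vilkovisky algebra structure on the bi-graded vector space `H = ⨁_d 𝒜 d`, where `Δ`
has bidegree `(0, 1)`. -/
structure BVAlgebra (H : Type*) [AddCommGroup H] [Module k H] (𝒜 : Bideg → Submodule k H) where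
  one : H
  mul : H →ₗ[k] H →ₗ[k] H
  Δ : H →ₗ[k] H
  isInternal : DirectSum.IsInternal 𝒜
  one_mem : one ∈ 𝒜 0
  mul_mem : ∀ d e, ∀ a ∈ 𝒜 d, ∀ b ∈ 𝒜 e, mul a b ∈ 𝒜 (d + e)
  one_mul : ∀ a, mul one a = a
  mul_assoc : ∀ a b c, mul (mul a b) c = mul a (mul b c)
  mul_comm : ∀ d e, ∀ a ∈ 𝒜 d, ∀ b ∈ 𝒜 e, mul a b = csign k d e • mul b a
  Δ_mem : ∀ d, ∀ a ∈ 𝒜 d, Δ a ∈ 𝒜 (d + (0, 1))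
  Δ_sq : ∀ a, Δ (Δ a) = 0
  Δ_second_order : ∀ d e, ∀ a ∈ 𝒜 d, ∀ b ∈ 𝒜 e, ∀ c,
    Δ (mul (mul a b) c) = mul (Δ (mul a b)) c
      + csign k d (0, 1) • mul a (Δ (mul b c))
      + csign k e (d + (0, 1)) • mul b (Δ (mul a c))
      - mul (mul (Δ a) b) c
      - csign k d (0, 1) • mul (mul a (Δ b)) c
      - csign k (0, 1) (d + e) • mul (mul a b) (Δ c)

variable {k}

/-- Isomorphisms of Batalin-Vilkovisky algebras: bijective linear maps that preserve the bigrading,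
the unit, the product and the operator `Δ`. -/
structure BVIso {H H' : Type*} [AddCommGroup H] [Module k H] [AddCommGroup H'] [Module k H']
    {𝒜 : Bideg → Submodule k H} {𝒜' : Bideg → Submodule k H'}
    (B : BVAlgebra k H 𝒜) (B' : BVAlgebra k H' 𝒜') extends H ≃ₗ[k] H' where
  map_comp : ∀ d, (𝒜 d).map toLinearEquiv.toLinearMap = 𝒜' d
  map_one : toFun B.one = B'.one
  map_mul : ∀ a b, toFun (B.mul a b) = B'.mul (toFun a) (toFun b)
  map_Δ : ∀ a, toFun (B.Δ a) = B'.Δ (toFun a)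

end BV

/-! ### Poisson cohomology and its Batalin-Vilkovisky structure -/

section PoissonCohomology
variable {k : Type*} [Field k] {Z : Type*} [Fintype Z] [DecidableEq Z] {deg : Z → Bideg}

/-- The total Poisson cohomology. -/
abbrev HP (π : Polyvector k deg) : Type _ := Coh (cobdry π)

/-- The part of bidegree `d` of the Poisson cohomology; `HP^{s,t}` is the part of bidegree
`(-s, -t)`. -/
def HPcomp (π : Polyvector k deg) (d : Bideg) : Submodule k (HP π) :=
  Coh.part (cobdry π) (BSym.comp k (polyDeg deg) d)

/-- The total mixed Poisson homology. -/
abbrev MixedHP (π : Polyvector k deg) : Type _ := Coh (bdry π)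

/-- `B` is the Batalin-Vilkovisky algebra structure of the Poisson cohomology that belongs to the
mixed volume form `γ`: its product is induced by the wedge product, its operator is
`Δ = - PD⁻¹ ∘ d̃ ∘ PD`, where `PD [P] = [ι̃_P γ]` is an isomorphism from the Poisson cohomology to
the mixed Poisson homology, and `Δ` generates the Schouten-Nijenhuis bracket:
`[a, b] = (-1)^{w(a)} Δ(a b) - (-1)^{w(a)} Δ(a) b - a Δ(b)`. -/
structure IsPoissonBV (π : Polyvector k deg) (γ : MixedForm k deg)
    (B : BVAlgebra k (HP π) (HPcomp π)) : Prop where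
  one : ∃ e : LinearMap.ker (cobdry π), (e : Polyvector k deg) = 1 ∧ B.one = cls (cobdry π) e
  mul : Induces₂ (cobdry π) (fun P Q => P * Q) (fun a b => B.mul a b)
  delta : ∃ (PD : HP π ≃ₗ[k] MixedHP π) (D : MixedHP π →ₗ[k] MixedHP π),
    Induces (cobdry π) (bdry π) (fun P => contr P γ) PD ∧
    Induces (bdry π) (bdry π) mixD D ∧
    ∀ a, B.Δ a = -PD.symm (D (PD a))
  bracket : ∃ br : HP π →ₗ[k] HP π →ₗ[k] HP π,
    Induces₂ (cobdry π) (fun P Q => Bigraded.bracket P Q) (fun a b => br a b) ∧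
    ∀ d, ∀ a ∈ HPcomp π d, ∀ b, br a b =
      csign k (0, 1) d • B.Δ (B.mul a b) - csign k (0, 1) d • B.mul (B.Δ a) b - B.mul a (B.Δ b)

end PoissonCohomology

/-! ### The spaces `k^{m||n}` and `k^{n∧m}` -/

section Spaces
variable (k : Type*) [Field k] {m n : ℕ}

/-- The coordinates `x_i` (`Sum.inl i`) and `y_j` (`Sum.inr j`) of `k^{m||n}` have bidegrees
`(0, 0)` and `(1, 0)`. -/
def degA : Fin m ⊕ Fin n → Bideg := Sum.elim (fun _ => (0, 0)) (fun _ => (1, 0))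

/-- The coordinates `ξ_i` (`Sum.inl i`) and `η_j` (`Sum.inr j`) of `k^{n∧m}` have bidegrees
`(0, -1)` and `(-1, -1)`. -/
def degB : Fin m ⊕ Fin n → Bideg := Sum.elim (fun _ => (0, -1)) (fun _ => (-1, -1))

variable {k} in
/-- `γ` is a mixed volume form: it has bidegree `(-n, m)`, and `P ↦ ι̃_P γ` is an isomorphism from
the polyvectors of bidegree `(-i, -j)` to the mixed forms of bidegree `(-n - i, m - j)`, for all
`i, j`. -/
def IsMixedVolumeForm {deg : Fin m ⊕ Fin n → Bideg} (γ : MixedForm k deg) : Prop :=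
  γ ∈ BSym.comp k (mixDeg deg) (-(n : ℤ), (m : ℤ)) ∧
  ∀ i j : ℤ, Set.BijOn (fun P : Polyvector k deg => contr P γ)
    (BSym.comp k (polyDeg deg) (-i, -j)) (BSym.comp k (mixDeg deg) (-(n : ℤ) - i, (m : ℤ) - j))

variable {k} in
/-- `π` is unimodular: there is a mixed volume form that is a Poisson cycle. -/
def IsUnimodular {deg : Fin m ⊕ Fin n → Bideg} (π : Polyvector k deg) : Prop :=
  ∃ γ : MixedForm k deg, IsMixedVolumeForm γ ∧ bdry π γ = 0

/-- The standard mixed volume form: `dx_1 ∧ ⋯ ∧ dx_m ∧ y_1^* ∧ ⋯ ∧ y_n^*` on `k^{m||n}` and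
`ξ_1^* ∧ ⋯ ∧ ξ_m^* ∧ dη_1 ∧ ⋯ ∧ dη_n` on `k^{n∧m}`. -/
def stdVolume (deg : Fin m ⊕ Fin n → Bideg) : MixedForm k deg :=
  (List.ofFn fun i : Fin m => BSym.gen k (mixDeg deg) (Sum.inr (Sum.inl i))).prod *
    (List.ofFn fun j : Fin n => BSym.gen k (mixDeg deg) (Sum.inr (Sum.inr j))).prod

/-- The isomorphism from the polyvectors on `k^{m||n}` to those on `k^{n∧m}` given by
`x_i ↦ ∂_{ξ_i}`, `y_j ↦ ∂_{η_j}`, `∂_{x_i} ↦ -ξ_i`, `∂_{y_j} ↦ η_j`. The sign makes it compatible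
with the Schouten-Nijenhuis brackets. -/
def exchange : Polyvector k (degA (m := m) (n := n)) →ₐ[k] Polyvector k (degB (m := m) (n := n)) :=
  BSym.lift (Sum.elim
      (fun z => vect k degB z)
      (Sum.elim (fun i => -coord k degB (Sum.inl i)) (fun j => coord k degB (Sum.inr j)))) (by
    have hd : ∀ g : (Fin m ⊕ Fin n) ⊕ (Fin m ⊕ Fin n),
        polyDeg degB g.swap = polyDeg degA g := by
      rintro ((i | i) | (i | i)) <;> simp [polyDeg, degA, degB]
    have key : ∀ g : (Fin m ⊕ Fin n) ⊕ (Fin m ⊕ Fin n), ∃ c : k, Sum.elim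
        (fun z => vect k degB z)
        (Sum.elim (fun i => -coord k degB (Sum.inl i)) (fun j => coord k degB (Sum.inr j))) g =
          c • BSym.gen k (polyDeg degB) g.swap := by
      rintro ((i | i) | (i | i))
      · exact ⟨1, by simp [vect]⟩
      · exact ⟨1, by simp [vect]⟩
      · exact ⟨-1, by simp [coord]⟩
      · exact ⟨1, by simp [coord]⟩
    intro g h
    obtain ⟨c, hc⟩ := key g
    obtain ⟨c', hc'⟩ := key h
    rw [hc, hc', smul_mul_smul_comm, smul_mul_smul_comm, BSym.gen_mul_gen, hd, hd,
      smul_comm, mul_comm])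

end Spaces
end Bigraded
end

/-! Everything is governed by one operator on polyvectors, the divergence `Δ = -∑ (-1)^{w(z)} ∂/∂z
∂/∂(∂_z)`. It has bidegree `(0, 1)`, its square is zero, and its failure to be a derivation is the
Schouten-Nijenhuis bracket (`divergence_mul`). As the bracket is itself a derivation in its second
argument (`bracket_mul`), `Δ` has order two. So the polyvectors with `Δ` satisfy the
Batalin-Vilkovisky identities before any cohomology is taken.

Contraction of the standard volume form is an algebraic Fourier transform: it exchanges
multiplication by half of the generators with differentiation. An explicit inverse shows that it is
bijective (`contrVolume`), and it carries `Δ` to `-d̃` (`mixD_contr`). Hence it carries `P ↦ Δ(πP) -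
πΔP` to `∂_π` (`bdry_contr`).

Any other mixed volume form is the contraction of the standard one by a unit of bidegree zero. The
part of bidegree zero is a polynomial ring, whose units are the constants. So unimodularity is the
single equation `Δπ = 0` (`isUnimodular_iff`). Under it, `Δ(πP) - πΔP` equals `[π, P]`, and `[π, P]`
agrees with `δ^π P` up to the involution `(-1)^w`. Thus contraction induces Poincaré duality, `Δ`
commutes with `δ^π`, and the structure descends to cohomology.

The exchange map permutes the generators up to sign and commutes with `Δ` (`exchange_divergence`).
The bracket can be written through `Δ`, the product and the weight, so it is preserved too. The
exchange sends `π` to its Koszul dual (`exchange_quadBivector`), and this transports the Poisson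
condition, unimodularity and the Batalin-Vilkovisky structure. -/

noncomputable section

namespace Bigraded

/-! ### Elementary sign arithmetic. -/

section Signs
variable (k : Type*) [Field k]

theorem neg_one_zpow_congr {a b : ℤ} (h : Even (a - b)) : (-1 : k) ^ a = (-1 : k) ^ b := by
  have e : a = b + (a - b) := by ring
  rw [e, zpow_add₀ (by norm_num), h.neg_one_zpow, mul_one]

theorem csign_self_mul_cancel (a b : Bideg) (c : k) : csign k a b * (csign k a b * c) = c := by
  rw [← mul_assoc, csign_sq, one_mul]

end Signs

/-! ### Products, twists and derivations of homogeneous elements. -/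

namespace BSym
variable {k : Type*} [Field k] {G : Type*} {deg : G → Bideg}

theorem algHom_ext {B : Type*} [Ring B] [Algebra k B] {f g : BSym k deg →ₐ[k] B}
    (h : ∀ a, f (gen k deg a) = g (gen k deg a)) : f = g := by
  ext x
  induction x using BSym.induction with
  | one => simp
  | add x y hx hy => simp [hx, hy]
  | smul c x hx => simp [hx]
  | mul a x hx => simp [hx, h]

theorem prod_mem_comp (l : List G) : (l.map (gen k deg)).prod ∈ comp k deg (l.map deg).sum :=
  Submodule.subset_span ⟨l, rfl, rfl⟩

theorem mul_mem_comp {d e : Bideg} {x y : BSym k deg} (hx : x ∈ comp k deg d)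
    (hy : y ∈ comp k deg e) : x * y ∈ comp k deg (d + e) := by
  have h := Submodule.mul_mem_mul hx hy
  rw [comp, comp, Submodule.span_mul_span] at h
  refine Submodule.span_mono ?_ h
  rintro _ ⟨_, ⟨l, rfl, rfl⟩, _, ⟨l', rfl, rfl⟩, rfl⟩
  exact ⟨l ++ l', by simp, by simp⟩

theorem gen_mul_mem_comp {d e : Bideg} {x : BSym k deg} (g : G) (hx : x ∈ comp k deg d)
    (h : deg g + d = e) : gen k deg g * x ∈ comp k deg e :=
  h ▸ mul_mem_comp (gen_mem_comp g) hx

theorem comp_commute {d e : Bideg} {x y : BSym k deg} (hx : x ∈ comp k deg d)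
    (hy : y ∈ comp k deg e) : x * y = csign k d e • (y * x) := by
  induction hy using Submodule.span_induction with
  | mem y hy =>
    obtain ⟨l, rfl, rfl⟩ := hy
    induction l with
    | nil => simp [csign_comm k d, csign_zero_left]
    | cons g l ih =>
      simp only [List.map_cons, List.sum_cons, List.prod_cons]
      rw [← mul_assoc, comp_mul_gen hx, smul_mul_assoc, mul_assoc, ih, mul_smul_comm, smul_smul,
        csign_add_right, mul_assoc]
  | zero => simp
  | add y z _ _ hy hz => rw [mul_add, add_mul, hy, hz, smul_add]
  | smul c y _ hy => rw [mul_smul_comm, hy, smul_mul_assoc, smul_comm]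

@[simp] theorem twist_gen (e : Bideg) (g : G) :
    twist e (gen k deg g) = csign k e (deg g) • gen k deg g := lift_gen _ _ g

theorem twist_of_mem {d : Bideg} (e : Bideg) {x : BSym k deg} (hx : x ∈ comp k deg d) :
    twist e x = csign k e d • x := by
  induction hx using Submodule.span_induction with
  | mem x hx =>
    obtain ⟨l, rfl, rfl⟩ := hx
    induction l with
    | nil => simp [csign_comm k e, csign_zero_left]
    | cons g l ih =>
      simp only [List.map_cons, List.sum_cons, List.prod_cons]
      rw [map_mul, ih, twist_gen, smul_mul_smul_comm, csign_add_right]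
  | zero => simp
  | add x y _ _ hx hy => rw [map_add, hx, hy, smul_add]
  | smul c x _ hx => rw [map_smul, hx, smul_comm]

theorem twist_twist (e : Bideg) (x : BSym k deg) : twist e (twist e x) = x := by
  have h : (twist e).comp (twist e) = AlgHom.id k (BSym k deg) := by
    refine algHom_ext fun a => ?_
    simp [smul_smul, csign_sq]
  exact DFunLike.congr_fun h x

theorem der_mem_comp {d : Bideg} (e : Bideg) (v : G → BSym k deg)
    (hv : ∀ g, v g ∈ comp k deg (e + deg g)) {x : BSym k deg} (hx : x ∈ comp k deg d) :
    der e v hv x ∈ comp k deg (e + d) := by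
  induction hx using Submodule.span_induction with
  | mem x hx =>
    obtain ⟨l, rfl, rfl⟩ := hx
    induction l with
    | nil => simp [der_one]
    | cons g l ih =>
      simp only [List.map_cons, List.sum_cons, List.prod_cons]
      rw [der_mul, der_gen, twist_gen, smul_mul_assoc]
      refine Submodule.add_mem _ ?_ (Submodule.smul_mem _ _ (gen_mul_mem_comp g ih (by abel)))
      rw [← add_assoc]
      exact mul_mem_comp (hv g) (prod_mem_comp l)
  | zero => simp
  | add x y _ _ hx hy => rw [map_add]; exact Submodule.add_mem _ hx hy
  | smul c x _ hx => rw [map_smul]; exact Submodule.smul_mem _ _ hx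

theorem partialD_mem_comp [DecidableEq G] {d : Bideg} (g : G) {x : BSym k deg}
    (hx : x ∈ comp k deg d) : partialD g x ∈ comp k deg (-deg g + d) :=
  der_mem_comp _ _ _ hx

theorem partialD_mul [DecidableEq G] {d : Bideg} (g : G) {x : BSym k deg}
    (hx : x ∈ comp k deg d) (y : BSym k deg) :
    partialD g (x * y) = partialD g x * y + csign k (deg g) d • (x * partialD g y) := by
  unfold partialD
  rw [der_mul, twist_of_mem _ hx, csign_neg_left, smul_mul_assoc]

theorem rightD_of_mem [DecidableEq G] {d : Bideg} (g : G) {x : BSym k deg}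
    (hx : x ∈ comp k deg d) :
    rightD g x = (csign k (deg g) (deg g) * csign k (deg g) d) • partialD g x := by
  simp [rightD, twist_of_mem _ hx, smul_smul]

/-! ### The homogeneous components -/

/-- The algebra map `x ↦ x t^d` for `x` of bidegree `d`. -/
def gradeHom : BSym k deg →ₐ[k] AddMonoidAlgebra (BSym k deg) Bideg :=
  lift (fun g => AddMonoidAlgebra.single (deg g) (gen k deg g)) (by
    intro g h
    rw [AddMonoidAlgebra.single_mul_single, AddMonoidAlgebra.single_mul_single, gen_mul_gen,
      add_comm, AddMonoidAlgebra.smul_single])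

theorem gradeHom_of_mem {d : Bideg} {x : BSym k deg} (hx : x ∈ comp k deg d) :
    gradeHom x = AddMonoidAlgebra.single d x := by
  induction hx using Submodule.span_induction with
  | mem x hx =>
    obtain ⟨l, rfl, rfl⟩ := hx
    induction l with
    | nil => simp [AddMonoidAlgebra.one_def]
    | cons g l ih =>
      simp only [List.map_cons, List.sum_cons, List.prod_cons]
      rw [map_mul, ih, gradeHom, lift_gen, AddMonoidAlgebra.single_mul_single]
  | zero => simp
  | add x y _ _ hx hy => rw [map_add, hx, hy, AddMonoidAlgebra.single_add]
  | smul c x _ hx => rw [map_smul, hx, AddMonoidAlgebra.smul_single]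

/-- The projection to the component of bidegree `d`. -/
def proj (d : Bideg) : BSym k deg →ₗ[k] BSym k deg where
  toFun x := (gradeHom x).coeff d
  map_add' x y := by rw [map_add]; rfl
  map_smul' c x := by rw [map_smul]; rfl

/-- Recording the bidegree as an exponent in a group algebra separates the components, so no basis
of the free commutative algebra is needed to see that they are independent. -/
theorem proj_of_mem {d : Bideg} {x : BSym k deg} (hx : x ∈ comp k deg d) (e : Bideg) :
    proj e x = if e = d then x else 0 := by
  have h : proj e x = (gradeHom x).coeff e := rfl
  rw [h, gradeHom_of_mem hx, AddMonoidAlgebra.coeff_single, Finsupp.single_apply]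
  simp only [eq_comm]

theorem iSup_comp : ⨆ d, comp k deg d = ⊤ := by
  rw [eq_top_iff]
  rintro x -
  induction x using BSym.induction with
  | one => exact Submodule.mem_iSup_of_mem 0 one_mem_comp
  | add x y hx hy => exact Submodule.add_mem _ hx hy
  | smul c x hx => exact Submodule.smul_mem _ _ hx
  | mul g x hx =>
    induction hx using Submodule.iSup_induction' with
    | mem d x hx => exact Submodule.mem_iSup_of_mem _ (gen_mul_mem_comp g hx rfl)
    | zero => simp
    | add x y _ _ hx hy => rw [mul_add]; exact Submodule.add_mem _ hx hy

/-- Sign rules only make sense on homogeneous elements; this extends identities that are additive in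
`x` to all elements. -/
theorem homogeneous_induction {P : BSym k deg → Prop}
    (mem : ∀ d, ∀ x ∈ comp k deg d, P x) (add : ∀ x y, P x → P y → P (x + y))
    (x : BSym k deg) : P x := by
  have hx : x ∈ ⨆ d, comp k deg d := iSup_comp (k := k) (deg := deg) ▸ Submodule.mem_top
  induction hx using Submodule.iSup_induction' with
  | mem d x hx => exact mem d x hx
  | zero => exact mem 0 0 (Submodule.zero_mem _)
  | add x y _ _ hx hy => exact add _ _ hx hy

theorem proj_mem (d : Bideg) (x : BSym k deg) : proj d x ∈ comp k deg d := by
  induction x using homogeneous_induction with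
  | mem e x hx =>
    rw [proj_of_mem hx]
    split_ifs with h
    · exact h ▸ hx
    · exact Submodule.zero_mem _
  | add x y hx hy => rw [map_add]; exact Submodule.add_mem _ hx hy

theorem exists_sum_proj (x : BSym k deg) : ∃ s : Finset Bideg, x = ∑ d ∈ s, proj d x := by
  classical
  -- The sum of two elements needs a common index set, so the claim is strengthened to every finite
  -- set containing `s`.
  suffices h : ∃ s : Finset Bideg, ∀ t, s ⊆ t → x = ∑ d ∈ t, proj d x by
    obtain ⟨s, hs⟩ := h
    exact ⟨s, hs s subset_rfl⟩
  induction x using homogeneous_induction with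
  | mem e x hx =>
    refine ⟨{e}, fun t ht => ?_⟩
    have he : e ∈ t := ht (Finset.mem_singleton_self e)
    simp [proj_of_mem hx, he]
  | add x y hx hy =>
    obtain ⟨s, hs⟩ := hx
    obtain ⟨t, ht⟩ := hy
    refine ⟨s ∪ t, fun u hu => ?_⟩
    simp only [map_add, Finset.sum_add_distrib]
    rw [← hs u (Finset.union_subset_left hu), ← ht u (Finset.union_subset_right hu)]

/-- A linear map of bidegree `e` commutes with the projections. -/
theorem proj_comm {H : Type*} {deg' : H → Bideg} (e : Bideg) (f : BSym k deg →ₗ[k] BSym k deg')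
    (hf : ∀ d, ∀ x ∈ comp k deg d, f x ∈ comp k deg' (d + e)) (d : Bideg) (x : BSym k deg) :
    f (proj d x) = proj (d + e) (f x) := by
  induction x using homogeneous_induction with
  | mem d' x hx =>
    rw [proj_of_mem hx, proj_of_mem (hf _ _ hx)]
    by_cases h : d = d' <;> simp [h]
  | add x y hx hy => simp only [map_add, hx, hy]

end BSym

open BSym

/-! ### Parity and weight signs of the polyvector generators. -/

section Signs
variable (k : Type*) [Field k]

theorem csign_weight (a : Bideg) : csign k (0, 1) a = (-1 : k) ^ a.2 := by
  simp [csign]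

theorem csign_parity (a : Bideg) : csign k (1, 0) a = (-1 : k) ^ a.1 := by
  simp [csign]

theorem csign_weight_weight : csign k (0, 1) (0, 1) = -1 := by
  simp [csign]

theorem csign_self (a : Bideg) : csign k a a = (-1 : k) ^ a.1 * (-1 : k) ^ a.2 := by
  rw [csign, ← zpow_add₀ (neg_ne_zero.2 one_ne_zero)]
  apply neg_one_zpow_congr
  have h (x : ℤ) : Even (x * x - x) := by
    have := Int.even_mul_pred_self x
    rwa [mul_sub, mul_one] at this
  have h' : a.1 * a.1 + a.2 * a.2 - (a.1 + a.2) = (a.1 * a.1 - a.1) + (a.2 * a.2 - a.2) := by ring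
  rw [h']
  exact (h _).add (h _)

variable {Z : Type*} (deg : Z → Bideg)

theorem polyDeg_inl (z : Z) : polyDeg deg (Sum.inl z) = deg z := rfl

theorem polyDeg_inr (z : Z) : polyDeg deg (Sum.inr z) = -deg z + -(0, 1) := rfl

end Signs

/-! ### Two commutation rules for polyvectors. -/

section Commutation
variable {k : Type*} [Field k] {Z : Type*} {deg : Z → Bideg}

/-- Each composite `∂/∂z ∂/∂(∂_z)` has bidegree `(0, 1)` whatever `z` is, and two operators of that
bidegree anticommute. -/
theorem partialD_partialD_comm [DecidableEq Z] (z w : Z) (P : Polyvector k deg) :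
    partialD (Sum.inl z) (partialD (Sum.inr z) (partialD (Sum.inl w) (partialD (Sum.inr w) P))) =
      -partialD (Sum.inl w)
        (partialD (Sum.inr w) (partialD (Sum.inl z) (partialD (Sum.inr z) P))) := by
  rw [partialD_comm (Sum.inr z) (Sum.inl w), map_smul, partialD_comm (Sum.inl z) (Sum.inl w),
    partialD_comm (Sum.inr z) (Sum.inr w), map_smul, map_smul,
    partialD_comm (Sum.inl z) (Sum.inr w), map_smul, smul_smul, smul_smul, smul_smul,
    ← neg_one_smul k]
  congr 1
  have s1 := csign_sq k (deg z) (deg w)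
  have s2 := csign_sq k (deg z) (0, 1)
  have s3 := csign_sq k (deg w) (0, 1)
  simp only [polyDeg_inl, polyDeg_inr, csign_add_left, csign_add_right, csign_neg_left,
      csign_neg_right, csign_weight_weight, csign_comm k (0, 1)]
  grind

/-- The bidegree `(0, -2)` is twice another one, so its sign against anything is trivial. -/
theorem bivector_comm {π : Polyvector k deg} (hπ : π ∈ comp k (polyDeg deg) (0, -2))
    (P : Polyvector k deg) :
    P * π = π * P := by
  induction P using homogeneous_induction with
  | mem d P hP =>
    have e : ((0, -2) : Bideg) = -((0, 1) + (0, 1)) := by ext <;> simp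
    rw [comp_commute hP hπ, e, csign_neg_right, csign_add_right, csign_sq, one_smul]
  | add P P' h h' => simp only [mul_add, add_mul, h, h']

end Commutation

/-! ### The divergence as a Batalin-Vilkovisky operator. -/

section Divergence
variable {k : Type*} [Field k] {Z : Type*} [Fintype Z] [DecidableEq Z] {deg : Z → Bideg}

/-- The divergence operator `-∑_z (-1)^{w(z)} ∂/∂z ∂/∂(∂_z)` on the polyvectors. -/
def divergence : Polyvector k deg →ₗ[k] Polyvector k deg :=
  -∑ z, (-1 : k) ^ (deg z).2 • (partialD (Sum.inl z) ∘ₗ partialD (Sum.inr z))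

theorem divergence_apply (P : Polyvector k deg) :
    divergence P = -∑ z, (-1 : k) ^ (deg z).2 • partialD (Sum.inl z) (partialD (Sum.inr z) P) := by
  simp [divergence]

theorem bracket_apply (P Q : Polyvector k deg) :
    bracket P Q = ∑ z, (rightD (Sum.inr z) P * partialD (Sum.inl z) Q -
      (-1 : k) ^ (deg z).1 • (rightD (Sum.inl z) P * partialD (Sum.inr z) Q)) := by
  simp [bracket]

theorem divergence_mem_comp {d : Bideg} {P : Polyvector k deg} (hP : P ∈ comp k (polyDeg deg) d) :
    divergence P ∈ comp k (polyDeg deg) (d + (0, 1)) := by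
  rw [divergence_apply]
  refine Submodule.neg_mem _ (Submodule.sum_mem _ fun z _ => Submodule.smul_mem _ _ ?_)
  have h := partialD_mem_comp (Sum.inl z) (partialD_mem_comp (Sum.inr z) hP)
  convert h using 1
  rw [polyDeg_inl, polyDeg_inr]
  generalize ((0, 1) : Bideg) = s
  rw [neg_add, neg_neg, neg_neg, add_assoc, neg_add_cancel_left, add_comm]

theorem divergence_one : divergence (1 : Polyvector k deg) = 0 := by
  simp [divergence_apply, partialD_one]

/-- The divergence operator generates the Schouten-Nijenhuis bracket. -/
theorem divergence_mul {d : Bideg} {P : Polyvector k deg} (hP : P ∈ comp k (polyDeg deg) d)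
    (Q : Polyvector k deg) :
    divergence (P * Q) = divergence P * Q + csign k (0, 1) d • (P * divergence Q) +
      csign k (0, 1) d • bracket P Q := by
  simp only [divergence_apply, bracket_apply, mul_neg, neg_mul, Finset.sum_mul, Finset.mul_sum,
    Finset.smul_sum, smul_neg, ← Finset.sum_neg_distrib, ← Finset.sum_add_distrib]
  refine Finset.sum_congr rfl fun z _ => ?_
  -- For each coordinate, expand by the Leibniz rule twice: the two terms where both derivatives hit
  -- the same factor give the divergences, the two mixed terms give the bracket.
  rw [partialD_mul _ hP, map_add, map_smul, partialD_mul _ (partialD_mem_comp _ hP),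
    partialD_mul _ hP, rightD_of_mem _ hP, rightD_of_mem _ hP]
  have s1 := csign_sq k (deg z) d
  have s2 := csign_sq k (0, 1) d
  have s3 := csign_sq k (0, 1) (deg z)
  have s4 := csign_sq k (1, 0) (deg z)
  simp only [csign_weight k (deg z), csign_parity] at s3 s4
  simp only [polyDeg_inl, polyDeg_inr, csign_add_left, csign_add_right, csign_neg_left,
      csign_neg_right, csign_weight_weight, csign_weight k (deg z), csign_comm k (deg z) (0, 1),
      csign_self k (deg z)]
  generalize csign k (deg z) d = a at *
  generalize csign k (0, 1) d = b at *
  generalize (-1 : k) ^ (deg z).1 = p at *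
  generalize (-1 : k) ^ (deg z).2 = w at *
  simp only [smul_mul_assoc, mul_smul_comm, smul_add, smul_sub, smul_smul]
  match_scalars <;> grind

/-- The Schouten-Nijenhuis bracket is a derivation in the second argument. -/
theorem bracket_mul {d e : Bideg} {P Q : Polyvector k deg} (hP : P ∈ comp k (polyDeg deg) d)
    (hQ : Q ∈ comp k (polyDeg deg) e) (S : Polyvector k deg) :
    bracket P (Q * S) = bracket P Q * S + csign k e (d + (0, 1)) • (Q * bracket P S) := by
  simp only [bracket_apply, Finset.sum_mul, Finset.mul_sum,
    Finset.smul_sum, ← Finset.sum_add_distrib]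
  refine Finset.sum_congr rfl fun z _ => ?_
  rw [partialD_mul _ hQ, partialD_mul _ hQ, rightD_of_mem _ hP, rightD_of_mem _ hP]
  have h1 := comp_commute (partialD_mem_comp (Sum.inr z) hP) hQ
  have h2 := comp_commute (partialD_mem_comp (Sum.inl z) hP) hQ
  have s1 := csign_sq k (deg z) e
  simp only [smul_mul_assoc, mul_smul_comm, mul_add, mul_sub, sub_mul, ← mul_assoc, h1, h2,
    smul_add, smul_sub, smul_smul]
  simp only [polyDeg_inl, polyDeg_inr, csign_add_left, csign_add_right, csign_neg_left,
      csign_neg_right, csign_comm k e]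
  generalize csign k (deg z) e = a at *
  match_scalars <;> grind

/-- The double sum is antisymmetric in its two indices, so `Δ²` equals its own negative;
characteristic zero finishes. -/
theorem divergence_divergence [CharZero k] (P : Polyvector k deg) :
    divergence (divergence P) = 0 := by
  have h : divergence (divergence P) = -divergence (divergence P) := by
    simp only [divergence_apply, map_neg, map_sum, map_smul, smul_neg, Finset.sum_neg_distrib,
      neg_neg, Finset.smul_sum]
    conv_lhs => rw [Finset.sum_comm]
    rw [← Finset.sum_neg_distrib]
    refine Finset.sum_congr rfl fun z _ => ?_
    rw [← Finset.sum_neg_distrib]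
    refine Finset.sum_congr rfl fun w _ => ?_
    rw [partialD_partialD_comm, smul_neg, smul_neg, smul_comm]
  have h2 : (2 : k) • divergence (divergence P) = 0 := by
    rw [two_smul]
    exact add_eq_zero_iff_eq_neg.2 h
  exact (smul_eq_zero.1 h2).resolve_left two_ne_zero

/-- The grading involution `P ↦ (-1)^{w(P)} P`. -/
abbrev weightInv : Polyvector k deg →ₐ[k] Polyvector k deg := twist (0, 1)

/-- The involution absorbs the sign `(-1)^{w(P)}`, so the formula for the bracket in terms of `Δ`
holds for inhomogeneous `P` as well. -/
theorem bracket_eq (P Q : Polyvector k deg) :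
    bracket P Q = divergence (weightInv P * Q) - divergence (weightInv P) * Q -
      P * divergence Q := by
  induction P using homogeneous_induction with
  | mem d P hP =>
    rw [twist_of_mem _ hP, map_smul, smul_mul_assoc, map_smul, divergence_mul hP, smul_mul_assoc]
    simp only [smul_add, smul_smul, csign_sq, one_smul]
    abel
  | add P P' h h' =>
    simp only [map_add, add_mul, LinearMap.add_apply, h, h']
    abel

theorem divergence_weightInv (P : Polyvector k deg) :
    divergence (weightInv P) = -weightInv (divergence P) := by
  induction P using homogeneous_induction with
  | mem d P hP =>
    rw [twist_of_mem _ hP, twist_of_mem _ (divergence_mem_comp hP), map_smul, csign_add_right,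
      csign_weight_weight]
    simp
  | add P P' h h' => simp only [map_add, h, h', neg_add]

/-- The seven-term identity restates that the defect of `Δ`, namely the bracket, is a derivation in
its second argument. -/
theorem divergence_mul_mul {d e : Bideg} {P Q : Polyvector k deg}
    (hP : P ∈ comp k (polyDeg deg) d) (hQ : Q ∈ comp k (polyDeg deg) e) (S : Polyvector k deg) :
    divergence (P * Q * S) = divergence (P * Q) * S
      + csign k d (0, 1) • (P * divergence (Q * S))
      + csign k e (d + (0, 1)) • (Q * divergence (P * S))
      - divergence P * Q * S
      - csign k d (0, 1) • (P * divergence Q * S)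
      - csign k (0, 1) (d + e) • (P * Q * divergence S) := by
  have h1 := comp_commute hQ (divergence_mem_comp hP)
  have h2 := comp_commute hQ hP
  rw [mul_assoc P Q S, divergence_mul hP (Q * S), bracket_mul hP hQ, divergence_mul hP Q,
    divergence_mul hP S]
  have s1 := csign_sq k d e
  have s2 := csign_sq k (0, 1) d
  have s3 := csign_sq k (0, 1) e
  simp only [mul_add, add_mul, smul_mul_assoc, mul_smul_comm, ← mul_assoc, h1, h2, smul_add,
    smul_smul]
  simp only [csign_add_right, csign_comm k _ (0, 1), csign_comm k e d]
  match_scalars <;> grind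

end Divergence

/-! ### The Poisson differential of a divergence-free bivector. -/

section Unimodular
variable {k : Type*} [Field k] {Z : Type*} [Fintype Z] [DecidableEq Z] {deg : Z → Bideg}
  {π : Polyvector k deg}

/-- Since `π` has even weight and `Δπ = 0`, the bracket with `π` is the commutator of `Δ` with
multiplication by `π`. -/
theorem bracket_bivector (hπ : π ∈ comp k (polyDeg deg) (0, -2)) (hΔ : divergence π = 0)
    (P : Polyvector k deg) : bracket π P = divergence (π * P) - π * divergence P := by
  rw [bracket_eq, twist_of_mem _ hπ, map_smul, hΔ]
  simp [csign]

/-- Both sides are evaluated through `Δ` and agree because `π` is central; this replaces the graded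
antisymmetry of the bracket. -/
theorem cobdry_eq (hπ : π ∈ comp k (polyDeg deg) (0, -2)) (hΔ : divergence π = 0)
    (P : Polyvector k deg) : cobdry π P = bracket π (weightInv P) := by
  rw [bracket_bivector hπ hΔ, cobdry, LinearMap.flip_apply, bracket_eq, hΔ, mul_zero, sub_zero,
    bivector_comm hπ, bivector_comm hπ]

theorem bracket_bivector_mul (hπ : π ∈ comp k (polyDeg deg) (0, -2)) (P Q : Polyvector k deg) :
    bracket π (P * Q) = bracket π P * Q + weightInv P * bracket π Q := by
  induction P using homogeneous_induction with
  | mem d P hP =>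
    have e : ((0, -2) : Bideg) + (0, 1) = -(0, 1) := by ext <;> simp
    rw [bracket_mul hπ hP, twist_of_mem _ hP, smul_mul_assoc, e, csign_neg_right, csign_comm]
  | add P P' h h' =>
    simp only [map_add, add_mul, h, h']
    abel

theorem bracket_mem_comp (hπ : π ∈ comp k (polyDeg deg) (0, -2)) (hΔ : divergence π = 0)
    {d : Bideg} {P : Polyvector k deg}
    (hP : P ∈ comp k (polyDeg deg) d) : bracket π P ∈ comp k (polyDeg deg) (d + (0, -1)) := by
  rw [bracket_bivector hπ hΔ]
  refine Submodule.sub_mem _ ?_ ?_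
  · have h := divergence_mem_comp (mul_mem_comp hπ hP)
    have e : ((0, -2) : Bideg) + d + (0, 1) = d + (0, -1) := by
      ext <;> simp; ring
    rwa [e] at h
  · have h := mul_mem_comp hπ (divergence_mem_comp hP)
    have e : ((0, -2) : Bideg) + (d + (0, 1)) = d + (0, -1) := by
      ext <;> simp; ring
    rwa [e] at h

/-- The differential brackets with `π` from the right, which is why the Leibniz sign falls on `Q`
and not on `P`. -/
theorem cobdry_mul (hπ : π ∈ comp k (polyDeg deg) (0, -2)) (hΔ : divergence π = 0)
    (P Q : Polyvector k deg) :
    cobdry π (P * Q) = cobdry π P * weightInv Q + P * cobdry π Q := by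
  simp only [cobdry_eq hπ hΔ, map_mul, bracket_bivector_mul hπ, twist_twist]

theorem cobdry_one (hπ : π ∈ comp k (polyDeg deg) (0, -2)) (hΔ : divergence π = 0) :
    cobdry π 1 = 0 := by
  rw [cobdry_eq hπ hΔ, map_one, bracket_bivector hπ hΔ, mul_one, hΔ, divergence_one, mul_zero,
    sub_zero]

theorem cobdry_mem_comp (hπ : π ∈ comp k (polyDeg deg) (0, -2)) (hΔ : divergence π = 0)
    {d : Bideg} {P : Polyvector k deg}
    (hP : P ∈ comp k (polyDeg deg) d) : cobdry π P ∈ comp k (polyDeg deg) (d + (0, -1)) := by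
  rw [cobdry_eq hπ hΔ, twist_of_mem _ hP, map_smul]
  exact Submodule.smul_mem _ _ (bracket_mem_comp hπ hΔ hP)

theorem cobdry_weightInv (hπ : π ∈ comp k (polyDeg deg) (0, -2)) (hΔ : divergence π = 0)
    (P : Polyvector k deg) : cobdry π (weightInv P) = -weightInv (cobdry π P) := by
  induction P using homogeneous_induction with
  | mem d P hP =>
    rw [twist_of_mem _ hP, twist_of_mem _ (cobdry_mem_comp hπ hΔ hP), map_smul]
    have e : ((0, -1) : Bideg) = -(0, 1) := by ext <;> simp
    rw [e, csign_add_right, csign_neg_right, csign_weight_weight, mul_neg_one, neg_smul, neg_neg]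
  | add P P' h h' => simp only [map_add, h, h', neg_add]

/-- A commutator with `Δ` anticommutes with `Δ` because `Δ² = 0`. The involution in `cobdry_eq` also
anticommutes with `Δ`, so the two signs cancel. -/
theorem cobdry_divergence [CharZero k] (hπ : π ∈ comp k (polyDeg deg) (0, -2))
    (hΔ : divergence π = 0)
    (P : Polyvector k deg) : cobdry π (divergence P) = divergence (cobdry π P) := by
  simp only [cobdry_eq hπ hΔ, bracket_bivector hπ hΔ, map_sub, divergence_divergence,
    ← neg_eq_iff_eq_neg.2 (divergence_weightInv P), mul_neg, map_neg]
  simp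

end Unimodular

/-! ### Products of odd generators, and homogeneous actions. -/

namespace BSym
variable {k : Type*} [Field k] {G : Type*} {deg : G → Bideg}

theorem partialD_gen [DecidableEq G] (g h : G) :
    partialD g (gen k deg h) = if h = g then 1 else 0 := by
  simpa [partialD_one] using partialD_gen_mul (k := k) (deg := deg) g h 1

theorem partialD_mul_of_eq_zero [DecidableEq G] (g : G) (x : BSym k deg) {y : BSym k deg}
    (hy : partialD g y = 0) : partialD g (x * y) = partialD g x * y := by
  have h : partialD g (x * y) = partialD g x * y + twist (-deg g) x * partialD g y :=
    der_mul _ _ _ x y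
  rw [h, hy, mul_zero, add_zero]

theorem gen_mul_self [CharZero k] {g : G} (hg : csign k (deg g) (deg g) = -1) :
    gen k deg g * gen k deg g = 0 := by
  have h := gen_mul_gen k deg g g
  rw [hg, neg_one_smul] at h
  have h2 : (2 : k) • (gen k deg g * gen k deg g) = 0 := by
    rw [two_smul]
    exact add_eq_zero_iff_eq_neg.2 h
  exact (smul_eq_zero.1 h2).resolve_left two_ne_zero

/-- An algebra action of `BSym k deg` whose generators act by homogeneous maps is homogeneous. -/
theorem action_mem_comp {H : Type*} {deg' : H → Bideg}
    (A : BSym k deg →ₐ[k] Module.End k (BSym k deg'))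
    (hA : ∀ g e, ∀ x ∈ comp k deg' e, A (gen k deg g) x ∈ comp k deg' (deg g + e))
    {d e : Bideg} {P : BSym k deg} (hP : P ∈ comp k deg d) {x : BSym k deg'}
    (hx : x ∈ comp k deg' e) : A P x ∈ comp k deg' (d + e) := by
  induction hP using Submodule.span_induction with
  | mem P hP =>
    obtain ⟨l, rfl, rfl⟩ := hP
    induction l with
    | nil => simpa using hx
    | cons g l ih =>
      simp only [List.map_cons, List.sum_cons, List.prod_cons, map_mul, Module.End.mul_apply]
      rw [add_assoc]
      exact hA g _ _ ih
  | zero => simp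
  | add P Q _ _ hP hQ => rw [map_add]; exact Submodule.add_mem _ hP hQ
  | smul c P _ hP => rw [map_smul]; exact Submodule.smul_mem _ _ hP

section Wedge
variable {Z : Type*} (c : Z → k) (f : Z → G)

variable (deg) in
/-- The product of the multiples `c z • f z` of generators over a list. -/
def wedge (l : List Z) : BSym k deg := (l.map fun z => c z • gen k deg (f z)).prod

@[simp] theorem wedge_nil : wedge deg c f [] = 1 := rfl

@[simp] theorem wedge_cons (z : Z) (l : List Z) :
    wedge deg c f (z :: l) = c z • gen k deg (f z) * wedge deg c f l := by
  simp [wedge]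

theorem wedge_append (l l' : List Z) :
    wedge deg c f (l ++ l') = wedge deg c f l * wedge deg c f l' := by
  simp [wedge]

theorem wedge_mem_comp (l : List Z) :
    wedge deg c f l ∈ comp k deg (l.map fun z => deg (f z)).sum := by
  induction l with
  | nil => simp [one_mem_comp]
  | cons z l ih =>
    rw [wedge_cons, smul_mul_assoc]
    exact Submodule.smul_mem _ _ (gen_mul_mem_comp _ ih (by simp))

theorem gen_mul_wedge [CharZero k] {z : Z} (hz : csign k (deg (f z)) (deg (f z)) = -1)
    {l : List Z} (hl : z ∈ l) : gen k deg (f z) * wedge deg c f l = 0 := by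
  induction l with
  | nil => simp at hl
  | cons w l ih =>
    rw [wedge_cons, ← mul_assoc, mul_smul_comm]
    rcases List.mem_cons.1 hl with rfl | h
    · simp [gen_mul_self hz]
    · rw [gen_mul_gen, smul_mul_assoc, smul_mul_assoc, mul_assoc, ih h]
      simp

theorem partialD_wedge [DecidableEq G] {g : G} {l : List Z} (h : ∀ z ∈ l, f z ≠ g) :
    partialD g (wedge deg c f l) = 0 := by
  induction l with
  | nil => simp [partialD_one]
  | cons w l ih =>
    rw [wedge_cons, smul_mul_assoc, map_smul, partialD_gen_mul, if_neg (h w (by simp)),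
      ih fun z hz => h z (by simp [hz])]
    simp

end Wedge
end BSym

/-! ### Contraction of a volume form as a Fourier transform. -/

section Fourier
variable {k : Type*} [Field k] {Z : Type*} {deg : Z → Bideg}

variable (deg) in
/-- The generator of the polyvectors that acts on mixed forms by multiplication by the function-like
generator attached to `z`. -/
def baseGen (z : Z) : Z ⊕ Z := if Even ((deg z).1 + (deg z).2) then Sum.inl z else Sum.inr z

variable (deg) in
/-- The generator of the polyvectors that is conjugate to `baseGen deg z`. -/
def conjGen (z : Z) : Z ⊕ Z := if Even ((deg z).1 + (deg z).2) then Sum.inr z else Sum.inl z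

variable (k deg) in
/-- The sign with which `conjGen deg z` acts on mixed forms. -/
def conjSign (z : Z) : k := if Even ((deg z).1 + (deg z).2) then 1 else (-1) ^ (deg z).2

theorem conjSign_sq (z : Z) : conjSign k deg z * conjSign k deg z = 1 := by
  unfold conjSign
  split_ifs
  · simp
  · rw [← mul_zpow]; simp

theorem polyDeg_baseGen (z : Z) : polyDeg deg (baseGen deg z) = mixDeg deg (Sum.inl z) := by
  by_cases h : Even ((deg z).1 + (deg z).2) <;> simp [baseGen, polyDeg, mixDeg, baseDeg, h]

theorem polyDeg_conjGen (z : Z) : polyDeg deg (conjGen deg z) = -mixDeg deg (Sum.inr z) := by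
  by_cases h : Even ((deg z).1 + (deg z).2) <;> simp [conjGen, polyDeg, mixDeg, baseDeg, h] <;>
    ext <;> simp [add_comm]

/-- The function-like generator is chosen with `p + w` even, so its differential has `p + w` odd and
anticommutes with itself. -/
theorem csign_mixDeg_inr (z : Z) :
    csign k (mixDeg deg (Sum.inr z)) (mixDeg deg (Sum.inr z)) = -1 := by
  rw [csign_self, ← zpow_add₀ (neg_ne_zero.2 one_ne_zero)]
  suffices h : Even ((mixDeg deg (Sum.inr z)).1 + (mixDeg deg (Sum.inr z)).2 - 1) by
    rw [neg_one_zpow_congr k h, zpow_one]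
  by_cases h : Even ((deg z).1 + (deg z).2)
  · have e := h
    obtain ⟨r, hr⟩ := h
    simp only [mixDeg, baseDeg, e, Sum.elim_inr, if_true, Prod.fst_add, Prod.snd_add]
    exact ⟨r, by omega⟩
  · have e := h
    obtain ⟨r, hr⟩ := Int.not_even_iff_odd.1 h
    simp only [mixDeg, baseDeg, e, Sum.elim_inr, if_false, Prod.fst_add, Prod.snd_add,
      Prod.fst_neg, Prod.snd_neg]
    exact ⟨-r - 1, by omega⟩

theorem csign_conjGen (z : Z) :
    csign k (polyDeg deg (conjGen deg z)) (polyDeg deg (conjGen deg z)) = -1 := by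
  rw [polyDeg_conjGen, csign_neg_left, csign_neg_right, csign_mixDeg_inr]

theorem baseGen_inj {z w : Z} : baseGen deg z = baseGen deg w ↔ z = w := by
  refine ⟨fun h => ?_, fun h => h ▸ rfl⟩
  unfold baseGen at h
  split_ifs at h <;> simpa using h

theorem conjGen_inj {z w : Z} : conjGen deg z = conjGen deg w ↔ z = w := by
  refine ⟨fun h => ?_, fun h => h ▸ rfl⟩
  unfold conjGen at h
  split_ifs at h <;> simpa using h

theorem baseGen_ne_conjGen (z w : Z) : baseGen deg z ≠ conjGen deg w := by
  intro h
  by_cases hz : Even ((deg z).1 + (deg z).2) <;> by_cases hw : Even ((deg w).1 + (deg w).2) <;>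
    simp [baseGen, conjGen, hz, hw] at h
  · exact hw (h ▸ hz)
  · exact hz (h ▸ hw)

theorem eq_baseGen_or_conjGen (g : Z ⊕ Z) : (∃ z, g = baseGen deg z) ∨ ∃ z, g = conjGen deg z := by
  rcases g with z | z <;> by_cases h : Even ((deg z).1 + (deg z).2)
  · exact Or.inl ⟨z, by simp [baseGen, h]⟩
  · exact Or.inr ⟨z, by simp [conjGen, h]⟩
  · exact Or.inr ⟨z, by simp [conjGen, h]⟩
  · exact Or.inl ⟨z, by simp [baseGen, h]⟩

variable [DecidableEq Z]

theorem contr_baseGen (z : Z) (ω : MixedForm k deg) :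
    contr (gen k (polyDeg deg) (baseGen deg z)) ω = gen k (mixDeg deg) (Sum.inl z) * ω := by
  rw [contr, lift_gen]
  by_cases h : Even ((deg z).1 + (deg z).2) <;> simp [baseGen, contrGen, h]

theorem contr_conjGen (z : Z) (ω : MixedForm k deg) :
    contr (gen k (polyDeg deg) (conjGen deg z)) ω =
      conjSign k deg z • partialD (Sum.inr z) ω := by
  rw [contr, lift_gen]
  by_cases h : Even ((deg z).1 + (deg z).2) <;> simp [conjGen, conjSign, contrGen, h]

/-- The action of the mixed forms on the polyvectors in which `Sum.inl z` acts by multiplication by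
`baseGen deg z` and `Sum.inr z` by differentiation with respect to `conjGen deg z`. -/
def coContr : MixedForm k deg →ₐ[k] Module.End k (Polyvector k deg) :=
  BSym.lift (Sum.elim (fun z => LinearMap.mulLeft k (gen k (polyDeg deg) (baseGen deg z)))
    (fun z => conjSign k deg z • partialD (conjGen deg z))) (by
    rintro (z | z) (w | w) <;> ext P <;>
      simp only [Sum.elim_inl, Sum.elim_inr, Module.End.mul_apply, LinearMap.mulLeft_apply,
        LinearMap.smul_apply]
    · rw [← mul_assoc, gen_mul_gen, smul_mul_assoc, mul_assoc, polyDeg_baseGen, polyDeg_baseGen]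
    · rw [partialD_gen_mul, if_neg (baseGen_ne_conjGen _ _), zero_add, polyDeg_conjGen,
        polyDeg_baseGen, csign_neg_left, csign_comm, smul_comm (conjSign k deg w), smul_smul,
        csign_sq, one_smul, mul_smul_comm]
    · rw [partialD_gen_mul, if_neg (baseGen_ne_conjGen _ _), zero_add, polyDeg_conjGen,
        polyDeg_baseGen, csign_neg_left, mul_smul_comm, smul_comm]
    · rw [map_smul, map_smul, partialD_comm, polyDeg_conjGen, polyDeg_conjGen, csign_neg_left,
        csign_neg_right, smul_comm (conjSign k deg z) (conjSign k deg w),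
        smul_comm (conjSign k deg z) (csign k _ _), smul_comm (conjSign k deg w) (csign k _ _)])

theorem coContr_inl (z : Z) (P : Polyvector k deg) :
    coContr (gen k (mixDeg deg) (Sum.inl z)) P = gen k (polyDeg deg) (baseGen deg z) * P := by
  rw [coContr, lift_gen]
  rfl

theorem coContr_inr (z : Z) (P : Polyvector k deg) :
    coContr (gen k (mixDeg deg) (Sum.inr z)) P =
      conjSign k deg z • partialD (conjGen deg z) P := by
  rw [coContr, lift_gen]
  rfl

theorem contr_mem_comp {d e : Bideg} {P : Polyvector k deg} (hP : P ∈ comp k (polyDeg deg) d)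
    {ω : MixedForm k deg} (hω : ω ∈ comp k (mixDeg deg) e) :
    contr P ω ∈ comp k (mixDeg deg) (d + e) := by
  refine action_mem_comp contr (fun g e ω hω => ?_) hP hω
  rcases eq_baseGen_or_conjGen (deg := deg) g with ⟨z, rfl⟩ | ⟨z, rfl⟩
  · rw [contr_baseGen, polyDeg_baseGen]
    exact gen_mul_mem_comp _ hω rfl
  · rw [contr_conjGen, polyDeg_conjGen]
    exact Submodule.smul_mem _ _ (partialD_mem_comp _ hω)

theorem coContr_mem_comp {d e : Bideg} {ω : MixedForm k deg} (hω : ω ∈ comp k (mixDeg deg) d)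
    {P : Polyvector k deg} (hP : P ∈ comp k (polyDeg deg) e) :
    coContr ω P ∈ comp k (polyDeg deg) (d + e) := by
  refine action_mem_comp coContr (fun g e P hP => ?_) hω hP
  rcases g with z | z
  · rw [coContr_inl, ← polyDeg_baseGen]
    exact gen_mul_mem_comp _ hP rfl
  · rw [coContr_inr]
    have h := partialD_mem_comp (conjGen deg z) hP
    rw [polyDeg_conjGen, neg_neg] at h
    exact Submodule.smul_mem _ _ h

/-- One half of the Fourier dictionary: differentiation becomes multiplication. Both sides obey the
same commutation rules with every generator, and the hypothesis on `γ` makes them agree at `P = 1`.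
-/
theorem contr_partialD_conjGen {γ : MixedForm k deg}
    (hγ : ∀ z, gen k (mixDeg deg) (Sum.inr z) * γ = 0) (z : Z) (P : Polyvector k deg) :
    contr (partialD (conjGen deg z) P) γ =
      conjSign k deg z • (gen k (mixDeg deg) (Sum.inr z) * contr P γ) := by
  induction P using BSym.induction with
  | one => simp [partialD_one, hγ]
  | add P Q hP hQ => simp only [map_add, LinearMap.add_apply, hP, hQ, mul_add, smul_add]
  | smul c P hP => simp only [map_smul, LinearMap.smul_apply, hP, mul_smul_comm, smul_comm c]
  | mul g P hP =>
    rcases eq_baseGen_or_conjGen (deg := deg) g with ⟨w, rfl⟩ | ⟨w, rfl⟩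
    · rw [partialD_gen_mul, if_neg (baseGen_ne_conjGen _ _), zero_add, map_smul, map_mul, map_mul,
        LinearMap.smul_apply, Module.End.mul_apply, Module.End.mul_apply, hP, contr_baseGen,
        contr_baseGen, polyDeg_baseGen, polyDeg_conjGen, csign_neg_left, mul_smul_comm, ← mul_assoc,
        ← mul_assoc, gen_mul_gen _ _ (Sum.inr z), smul_mul_assoc, smul_comm]
    · rw [partialD_gen_mul, map_add, map_smul, map_mul, map_mul,
        LinearMap.add_apply, LinearMap.smul_apply, Module.End.mul_apply, Module.End.mul_apply, hP,
        contr_conjGen, contr_conjGen, map_smul, partialD_gen_mul, polyDeg_conjGen, polyDeg_conjGen,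
        csign_neg_left, csign_neg_right]
      have s := csign_sq k (mixDeg deg (Sum.inr z)) (mixDeg deg (Sum.inr w))
      have s' := csign_mixDeg_inr (k := k) (deg := deg) z
      have t := conjSign_sq (k := k) (deg := deg) z
      simp only [conjGen_inj, Sum.inr.injEq, csign_comm k (mixDeg deg (Sum.inr w)), mul_smul_comm]
      by_cases h : w = z
      · subst h
        simp only [if_true, s']
        match_scalars <;> grind
      · simp only [if_neg h, if_neg (Ne.symm h), map_zero, LinearMap.zero_apply]
        match_scalars
        grind

/-- The other half of the dictionary: generators acting by multiplication keep their derivatives,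
because `γ` does not involve the function-like generators. -/
theorem contr_partialD_baseGen {γ : MixedForm k deg}
    (hγ : ∀ z, partialD (Sum.inl z) γ = 0) (z : Z) (P : Polyvector k deg) :
    contr (partialD (baseGen deg z) P) γ = partialD (Sum.inl z) (contr P γ) := by
  induction P using BSym.induction with
  | one => simp [partialD_one, hγ]
  | add P Q hP hQ => simp only [map_add, LinearMap.add_apply, hP, hQ]
  | smul c P hP => simp only [map_smul, LinearMap.smul_apply, hP]
  | mul g P hP =>
    rcases eq_baseGen_or_conjGen (deg := deg) g with ⟨w, rfl⟩ | ⟨w, rfl⟩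
    · rw [partialD_gen_mul, map_add, map_smul, map_mul, map_mul, LinearMap.add_apply,
        LinearMap.smul_apply, Module.End.mul_apply, Module.End.mul_apply, hP, contr_baseGen,
        contr_baseGen, polyDeg_baseGen, polyDeg_baseGen, partialD_gen_mul]
      simp only [baseGen_inj, Sum.inl.injEq]
      split_ifs <;> simp
    · rw [partialD_gen_mul, if_neg (baseGen_ne_conjGen _ _).symm, zero_add, map_smul, map_mul,
        map_mul, LinearMap.smul_apply, Module.End.mul_apply, Module.End.mul_apply, hP,
        contr_conjGen, contr_conjGen, polyDeg_baseGen, polyDeg_conjGen, csign_neg_right, map_smul,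
        partialD_comm (Sum.inl z), smul_comm]

theorem coContr_partialD_inr {γ : Polyvector k deg}
    (hγ : ∀ z, gen k (polyDeg deg) (conjGen deg z) * γ = 0) (z : Z) (ω : MixedForm k deg) :
    coContr (partialD (Sum.inr z) ω) γ =
      conjSign k deg z • (gen k (polyDeg deg) (conjGen deg z) * coContr ω γ) := by
  induction ω using BSym.induction with
  | one => simp [partialD_one, hγ]
  | add P Q hP hQ => simp only [map_add, LinearMap.add_apply, hP, hQ, mul_add, smul_add]
  | smul c P hP => simp only [map_smul, LinearMap.smul_apply, hP, mul_smul_comm, smul_comm c]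
  | mul g P hP =>
    rcases g with w | w
    · rw [partialD_gen_mul, if_neg (by simp), zero_add, map_smul, map_mul, map_mul,
        LinearMap.smul_apply, Module.End.mul_apply, Module.End.mul_apply, hP, coContr_inl,
        coContr_inl, mul_smul_comm, ← mul_assoc, ← mul_assoc, gen_mul_gen _ _ (conjGen deg z),
        polyDeg_baseGen, polyDeg_conjGen, csign_neg_left, smul_mul_assoc, smul_comm]
    · rw [partialD_gen_mul, map_add, map_smul, map_mul, map_mul,
        LinearMap.add_apply, LinearMap.smul_apply, Module.End.mul_apply, Module.End.mul_apply, hP,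
        coContr_inr, coContr_inr, map_smul, partialD_gen_mul, polyDeg_conjGen, polyDeg_conjGen,
        csign_neg_left, csign_neg_right]
      have s := csign_sq k (mixDeg deg (Sum.inr z)) (mixDeg deg (Sum.inr w))
      have s' := csign_mixDeg_inr (k := k) (deg := deg) z
      have t := conjSign_sq (k := k) (deg := deg) z
      simp only [conjGen_inj, Sum.inr.injEq, csign_comm k (mixDeg deg (Sum.inr w)), mul_smul_comm]
      by_cases h : w = z
      · subst h
        simp only [if_true, s']
        match_scalars <;> grind
      · simp only [if_neg h, if_neg (Ne.symm h), map_zero, LinearMap.zero_apply]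
        match_scalars
        grind

/-- The two transforms intertwine the action of each generator, so their composite is fixed by its
value at `1`. -/
theorem coContr_contr {γ : MixedForm k deg} {γ' : Polyvector k deg}
    (hγ' : ∀ z, gen k (polyDeg deg) (conjGen deg z) * γ' = 0) (h1 : coContr γ γ' = 1)
    (P : Polyvector k deg) : coContr (contr P γ) γ' = P := by
  induction P using BSym.induction with
  | one => simpa using h1
  | add P Q hP hQ => simp only [map_add, LinearMap.add_apply, hP, hQ]
  | smul c P hP => simp only [map_smul, LinearMap.smul_apply, hP]
  | mul g P hP =>
    rw [map_mul, Module.End.mul_apply]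
    rcases eq_baseGen_or_conjGen (deg := deg) g with ⟨w, rfl⟩ | ⟨w, rfl⟩
    · rw [contr_baseGen, map_mul, Module.End.mul_apply, coContr_inl, hP]
    · rw [contr_conjGen, map_smul, LinearMap.smul_apply, coContr_partialD_inr hγ', smul_smul,
        conjSign_sq, one_smul, hP]

theorem contr_coContr {γ : MixedForm k deg} {γ' : Polyvector k deg}
    (hγ : ∀ z, gen k (mixDeg deg) (Sum.inr z) * γ = 0) (h1 : contr γ' γ = 1)
    (ω : MixedForm k deg) : contr (coContr ω γ') γ = ω := by
  induction ω using BSym.induction with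
  | one => simpa using h1
  | add P Q hP hQ => simp only [map_add, LinearMap.add_apply, hP, hQ]
  | smul c P hP => simp only [map_smul, LinearMap.smul_apply, hP]
  | mul g P hP =>
    rw [map_mul, Module.End.mul_apply]
    rcases g with w | w
    · rw [coContr_inl, map_mul, Module.End.mul_apply, contr_baseGen, hP]
    · rw [coContr_inr, map_smul, LinearMap.smul_apply, contr_partialD_conjGen hγ, smul_smul,
        conjSign_sq, one_smul, hP]

theorem mixD_eq_sum [Fintype Z] (ω : MixedForm k deg) :
    mixD ω = ∑ z, gen k (mixDeg deg) (Sum.inr z) * partialD (Sum.inl z) ω := by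
  have hmul (g : Z ⊕ Z) (ω : MixedForm k deg) : mixD (gen k (mixDeg deg) g * ω) =
      mixD (gen k (mixDeg deg) g) * ω + csign k (0, 1) (mixDeg deg g) •
        (gen k (mixDeg deg) g * mixD ω) := by
    unfold mixD
    rw [der_mul, twist_gen, smul_mul_assoc]
  induction ω using BSym.induction with
  | one => simp [mixD, der_one, partialD_one]
  | add P Q hP hQ => simp only [map_add, mul_add, hP, hQ, Finset.sum_add_distrib]
  | smul c P hP => simp only [map_smul, mul_smul_comm, hP, Finset.smul_sum]
  | mul g P hP =>
    rw [hmul, hP]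
    simp only [partialD_gen_mul, mul_add, Finset.sum_add_distrib]
    congr 1
    · rw [mixD, der_gen]
      rcases g with w | w <;> simp
    · rw [Finset.mul_sum, Finset.smul_sum]
      refine Finset.sum_congr rfl fun z _ => ?_
      have e : mixDeg deg (Sum.inr z) = mixDeg deg (Sum.inl z) + (0, 1) := rfl
      rw [mul_smul_comm, ← mul_assoc, ← mul_assoc, gen_mul_gen _ _ (Sum.inr z) g, smul_mul_assoc,
        smul_smul, e, csign_add_left, csign_self_mul_cancel]

/-- By `mixD_eq_sum`, `d̃` is a sum of products of a multiplication and a derivative. The Fourier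
dictionary turns each product into a second-order operator, which up to sign is a term of `Δ`. -/
theorem mixD_contr [Fintype Z] {γ : MixedForm k deg}
    (hγ : ∀ z, gen k (mixDeg deg) (Sum.inr z) * γ = 0)
    (hγ' : ∀ z, partialD (Sum.inl z) γ = 0) (P : Polyvector k deg) :
    mixD (contr P γ) = -contr (divergence P) γ := by
  rw [mixD_eq_sum, divergence_apply, map_neg, LinearMap.neg_apply, neg_neg, map_sum,
    LinearMap.sum_apply]
  refine Finset.sum_congr rfl fun z _ => ?_
  rw [← contr_partialD_baseGen hγ', map_smul, LinearMap.smul_apply]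
  have h1 : gen k (mixDeg deg) (Sum.inr z) * contr (partialD (baseGen deg z) P) γ =
      conjSign k deg z • contr (partialD (conjGen deg z) (partialD (baseGen deg z) P)) γ := by
    rw [contr_partialD_conjGen hγ, smul_smul, conjSign_sq, one_smul]
  rw [h1]
  -- For `z` even the two derivatives stand in the opposite order to that in `Δ`, and reordering
  -- them yields `(-1)^{w(z)}`. For `z` odd the order is already right and `conjSign` is that sign.
  by_cases h : Even ((deg z).1 + (deg z).2)
  · have e : csign k (deg z) (deg z) * csign k (deg z) (0, 1) = (-1 : k) ^ (deg z).2 := by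
      rw [csign_self, csign_comm k _ (0, 1), csign_weight, mul_assoc, ← mul_zpow]
      simp only [mul_neg, mul_one, neg_neg, one_zpow]
      apply neg_one_zpow_congr
      exact Int.even_sub.2 (Int.even_add.1 h)
    simp only [conjSign, conjGen, baseGen, h, if_true, one_smul]
    rw [partialD_comm, map_smul, LinearMap.smul_apply, polyDeg_inl, polyDeg_inr, csign_comm,
      csign_add_right, csign_neg_right, csign_neg_right, e]
  · simp only [conjSign, conjGen, baseGen, h, if_false]

end Fourier

/-! ### The Poisson boundary map. -/

section Differential
variable {k : Type*} [Field k] {Z : Type*} [DecidableEq Z] {deg : Z → Bideg}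

/-- Follows from `d̃² = 0`, because `∂_π` is a commutator with `d̃`. -/
theorem bdry_mixD (π : Polyvector k deg) (ω : MixedForm k deg) :
    bdry π (mixD ω) = -mixD (bdry π ω) := by
  have h (ω : MixedForm k deg) : mixD (mixD ω) = 0 := by
    have hmul (g : Z ⊕ Z) (ω : MixedForm k deg) : mixD (gen k (mixDeg deg) g * ω) =
        mixD (gen k (mixDeg deg) g) * ω + csign k (0, 1) (mixDeg deg g) •
          (gen k (mixDeg deg) g * mixD ω) := by
      unfold mixD
      rw [der_mul, twist_gen, smul_mul_assoc]
    have hone : mixD (1 : MixedForm k deg) = 0 := der_one _ _ _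
    have hl (z : Z) : mixD (gen k (mixDeg deg) (Sum.inl z)) = gen k (mixDeg deg) (Sum.inr z) := by
      rw [mixD, der_gen]; rfl
    have hr (z : Z) : mixD (gen k (mixDeg deg) (Sum.inr z)) = 0 := by
      rw [mixD, der_gen]; rfl
    induction ω using BSym.induction with
    | one => simp [hone]
    | add P Q hP hQ => simp only [map_add, hP, hQ, add_zero]
    | smul c P hP => simp only [map_smul, hP, smul_zero]
    | mul g P hP =>
      rw [hmul, map_add, map_smul, hmul g, hP, mul_zero, smul_zero, add_zero]
      rcases g with z | z
      · have e : mixDeg deg (Sum.inr z) = mixDeg deg (Sum.inl z) + (0, 1) := rfl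
        rw [hl, hmul, hr, zero_mul, zero_add, e, csign_add_right, csign_weight_weight]
        simp
      · rw [hr]
        simp
  simp only [bdry, LinearMap.sub_apply, LinearMap.comp_apply, map_sub, h, map_zero]
  abel

end Differential

section Boundary
variable {k : Type*} [Field k] {Z : Type*} [Fintype Z] [DecidableEq Z] {deg : Z → Bideg}

theorem bdry_contr {γ : MixedForm k deg}
    (hγ : ∀ z, gen k (mixDeg deg) (Sum.inr z) * γ = 0)
    (hγ' : ∀ z, partialD (Sum.inl z) γ = 0) (π P : Polyvector k deg) :
    bdry π (contr P γ) = contr (divergence (π * P) - π * divergence P) γ := by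
  have h (Q : Polyvector k deg) : contr π (contr Q γ) = contr (π * Q) γ := by
    rw [map_mul, Module.End.mul_apply]
  rw [bdry, LinearMap.sub_apply, LinearMap.comp_apply, LinearMap.comp_apply,
    mixD_contr hγ hγ', map_neg, h, h, mixD_contr hγ hγ', map_sub, LinearMap.sub_apply]
  abel

end Boundary

/-! ### The standard volume form and the criterion for unimodularity. -/

section Volume
variable {k : Type*} [Field k] {m n : ℕ} {deg : Fin m ⊕ Fin n → Bideg}

variable (m n) in
/-- The coordinates of `k^{m||n}` in their standard order. -/
def coordList : List (Fin m ⊕ Fin n) := List.ofFn Sum.inl ++ List.ofFn Sum.inr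

theorem mem_coordList (z : Fin m ⊕ Fin n) : z ∈ coordList m n := by
  rcases z with i | j <;> simp [coordList, List.mem_append, List.mem_ofFn]

theorem coordList_nodup : (coordList m n).Nodup := by
  rw [coordList, List.nodup_append']
  refine ⟨List.nodup_ofFn.2 Sum.inl_injective, List.nodup_ofFn.2 Sum.inr_injective, ?_⟩
  intro z hz hz'
  rw [List.mem_ofFn] at hz hz'
  obtain ⟨i, rfl⟩ := hz
  obtain ⟨j, hj⟩ := hz'
  cases hj

theorem stdVolume_eq_wedge :
    stdVolume k deg = wedge (mixDeg deg) (fun _ => (1 : k)) Sum.inr (coordList m n) := by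
  simp [stdVolume, wedge, coordList, List.map_ofFn, Function.comp_def]

variable (k deg) in
/-- The polyvector dual to the standard mixed volume form. -/
def dualVolume : Polyvector k deg :=
  wedge (polyDeg deg) (conjSign k deg) (conjGen deg) (coordList m n).reverse

theorem gen_mul_stdVolume [CharZero k] (z : Fin m ⊕ Fin n) :
    gen k (mixDeg deg) (Sum.inr z) * stdVolume k deg = 0 := by
  rw [stdVolume_eq_wedge]
  exact gen_mul_wedge _ _ (csign_mixDeg_inr z) (mem_coordList z)

theorem partialD_stdVolume (z : Fin m ⊕ Fin n) :
    partialD (Sum.inl z) (stdVolume k deg) = 0 := by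
  rw [stdVolume_eq_wedge]
  exact partialD_wedge _ _ (by simp)

theorem gen_mul_dualVolume [CharZero k] (z : Fin m ⊕ Fin n) :
    gen k (polyDeg deg) (conjGen deg z) * dualVolume k deg = 0 :=
  gen_mul_wedge _ _ (csign_conjGen z) (List.mem_reverse.2 (mem_coordList z))

/-- The dual volume lists the coordinates in reverse, so its factors act in the original order, each
stripping the current front factor of the volume form. As no coordinate is repeated, the rest is not
differentiated. -/
theorem contr_dualVolume : contr (dualVolume k deg) (stdVolume k deg) = 1 := by
  rw [stdVolume_eq_wedge, dualVolume]
  have hl := coordList_nodup (m := m) (n := n)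
  revert hl
  generalize coordList m n = l
  intro hl
  induction l with
  | nil => simp
  | cons z l ih =>
    rw [List.nodup_cons] at hl
    have h0 : partialD (Sum.inr z) (wedge (mixDeg deg) (fun _ => (1 : k)) Sum.inr l) = 0 :=
      partialD_wedge _ _ fun w hw h => hl.1 (Sum.inr_injective h ▸ hw)
    rw [List.reverse_cons, wedge_append, map_mul, Module.End.mul_apply, wedge_cons, wedge_cons,
      wedge_nil, mul_one, map_smul, LinearMap.smul_apply, contr_conjGen, one_smul,
      partialD_gen_mul, if_pos rfl, h0, mul_zero, smul_zero, add_zero, smul_smul, conjSign_sq,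
      one_smul, ih hl.2]

/-- Derivatives that kill the right factor act on the left factor only. This allows the dual volume
to be stripped from the front while its last factor waits. -/
theorem coContr_wedge_mul {l : List (Fin m ⊕ Fin n)} (P : Polyvector k deg) {Q : Polyvector k deg}
    (hQ : ∀ z ∈ l, partialD (conjGen deg z) Q = 0) :
    coContr (wedge (mixDeg deg) (fun _ => (1 : k)) Sum.inr l) (P * Q) =
      coContr (wedge (mixDeg deg) (fun _ => (1 : k)) Sum.inr l) P * Q := by
  induction l with
  | nil => simp
  | cons z l ih =>
    rw [wedge_cons, one_smul, map_mul coContr, Module.End.mul_apply, Module.End.mul_apply,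
      ih fun w hw => hQ w (by simp [hw]), coContr_inr, coContr_inr,
      partialD_mul_of_eq_zero _ _ (hQ z (by simp)), smul_mul_assoc]

theorem coContr_stdVolume : coContr (stdVolume k deg) (dualVolume k deg) = 1 := by
  rw [stdVolume_eq_wedge, dualVolume]
  have hl := coordList_nodup (m := m) (n := n)
  revert hl
  generalize coordList m n = l
  intro hl
  induction l with
  | nil => simp
  | cons z l ih =>
    rw [List.nodup_cons] at hl
    rw [List.reverse_cons, wedge_append, wedge_cons, one_smul, map_mul coContr,
      Module.End.mul_apply, coContr_wedge_mul, ih hl.2, one_mul, coContr_inr, wedge_cons, wedge_nil, mul_one, map_smul,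
      partialD_gen, if_pos rfl, smul_smul, conjSign_sq, one_smul]
    intro w hw
    rw [wedge_cons, wedge_nil, mul_one, map_smul, partialD_gen, if_neg, smul_zero]
    rw [conjGen_inj]
    rintro rfl
    exact hl.1 hw

variable (k deg) in
/-- The contraction of the standard mixed volume form. -/
def contrVolume [CharZero k] : Polyvector k deg ≃ₗ[k] MixedForm k deg :=
  LinearEquiv.ofLinearMap (contr.toLinearMap.flip (stdVolume k deg))
    (coContr.toLinearMap.flip (dualVolume k deg))
    (LinearMap.ext fun ω => contr_coContr gen_mul_stdVolume contr_dualVolume ω)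
    (LinearMap.ext fun P => coContr_contr gen_mul_dualVolume coContr_stdVolume P)

theorem contrVolume_apply [CharZero k] (P : Polyvector k deg) :
    contrVolume k deg P = contr P (stdVolume k deg) := rfl

theorem isMixedVolumeForm_stdVolume [CharZero k]
    (hx : ∀ i, mixDeg deg (Sum.inr (Sum.inl i)) = (0, 1))
    (hy : ∀ j, mixDeg deg (Sum.inr (Sum.inr j)) = (-1, 0)) :
    IsMixedVolumeForm (stdVolume k deg) := by
  have e1 : ((coordList m n).map fun z => mixDeg deg (Sum.inr z)).sum = (-(n : ℤ), (m : ℤ)) := by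
    simp only [coordList, List.map_append, List.map_ofFn, List.sum_append, Function.comp_def,
      hx, hy, List.sum_ofFn, Finset.sum_const, Finset.card_univ, Fintype.card_fin]
    ext <;> simp
  have e2 : ((coordList m n).reverse.map fun z => polyDeg deg (conjGen deg z)).sum =
      ((n : ℤ), -(m : ℤ)) := by
    simp only [polyDeg_conjGen]
    rw [List.map_reverse, List.sum_reverse]
    simp only [coordList, List.map_append, List.map_ofFn, List.sum_append, Function.comp_def,
      hx, hy, List.sum_ofFn, Finset.sum_const, Finset.card_univ, Fintype.card_fin]
    ext <;> simp
  have h1 : stdVolume k deg ∈ comp k (mixDeg deg) (-(n : ℤ), (m : ℤ)) := by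
    rw [← e1, stdVolume_eq_wedge]
    exact wedge_mem_comp _ _ _
  have h2 : dualVolume k deg ∈ comp k (polyDeg deg) ((n : ℤ), -(m : ℤ)) := by
    rw [← e2]
    exact wedge_mem_comp _ _ _
  refine ⟨h1, fun i j => ⟨fun P hP => ?_, (contrVolume k deg).injective.injOn, fun ω hω => ?_⟩⟩
  · have h := contr_mem_comp hP h1
    have e : (-i, -j) + (-(n : ℤ), (m : ℤ)) = (-(n : ℤ) - i, (m : ℤ) - j) := by
      ext <;> simp <;> ring
    rwa [e] at h
  · refine ⟨coContr ω (dualVolume k deg), ?_, (contrVolume k deg).apply_symm_apply ω⟩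
    have h := coContr_mem_comp hω h2
    have e : (-(n : ℤ) - i, (m : ℤ) - j) + ((n : ℤ), -(m : ℤ)) = (-i, -j) := by
      ext <;> simp <;> ring
    rwa [e] at h

theorem bdry_contrVolume [CharZero k] {π : Polyvector k deg}
    (hπ : π ∈ comp k (polyDeg deg) (0, -2)) (hΔ : divergence π = 0) (P : Polyvector k deg) :
    bdry π (contrVolume k deg P) = contrVolume k deg (bracket π P) := by
  rw [contrVolume_apply, contrVolume_apply, bdry_contr gen_mul_stdVolume partialD_stdVolume,
    bracket_bivector hπ hΔ]

theorem mixD_contrVolume [CharZero k] (P : Polyvector k deg) :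
    mixD (contrVolume k deg P) = -contrVolume k deg (divergence P) :=
  mixD_contr gen_mul_stdVolume partialD_stdVolume P

/-- If the units of bidegree zero are scalars, then a bivector is unimodular if and only if its
divergence vanishes. -/
theorem isUnimodular_iff [CharZero k] {π : Polyvector k deg}
    (hx : ∀ i, mixDeg deg (Sum.inr (Sum.inl i)) = (0, 1))
    (hy : ∀ j, mixDeg deg (Sum.inr (Sum.inr j)) = (-1, 0))
    (hu : ∀ f ∈ comp k (polyDeg deg) 0, ∀ g ∈ comp k (polyDeg deg) 0, g * f = 1 →
      ∃ c : k, c ≠ 0 ∧ f = c • 1) :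
    IsUnimodular π ↔ divergence π = 0 := by
  have hstd := isMixedVolumeForm_stdVolume (k := k) hx hy
  constructor
  · rintro ⟨γ, ⟨hγ, hγ'⟩, h⟩
    -- Bijectivity in bidegree zero for the standard form writes `γ` as its contraction by `f`; the
    -- same property of `γ` gives back the standard form through some `g`, so `f` is a unit.
    obtain ⟨f, hf, rfl⟩ : γ ∈ (fun P => contr P (stdVolume k deg)) ''
        (comp k (polyDeg deg) (-0, -0) : Set (Polyvector k deg)) := by
      rw [(hstd.2 0 0).image_eq]
      simpa using hγ
    obtain ⟨g, hg, hgf⟩ : stdVolume k deg ∈ (fun P => contr P (contr f (stdVolume k deg))) ''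
        (comp k (polyDeg deg) (-0, -0) : Set (Polyvector k deg)) := by
      rw [(hγ' 0 0).image_eq]
      simpa using hstd.1
    have e : ((-0, -0) : Bideg) = 0 := by simp
    rw [e] at hf hg
    have h1 : g * f = 1 := by
      apply (contrVolume k deg).injective
      rw [contrVolume_apply, contrVolume_apply, map_mul, Module.End.mul_apply, map_one]
      exact hgf
    obtain ⟨c, hc, rfl⟩ := hu f hf g hg h1
    -- With `f = c` constant, `∂_π γ` is the contraction of the standard form by `c • Δπ`.
    rw [bdry_contr gen_mul_stdVolume partialD_stdVolume, map_smul, divergence_one, smul_zero,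
      mul_zero, sub_zero, mul_smul_comm, mul_one, map_smul] at h
    have h2 := (contrVolume k deg).injective (h.trans (map_zero (contrVolume k deg)).symm)
    exact (smul_eq_zero.1 h2).resolve_left hc
  · intro h
    refine ⟨stdVolume k deg, hstd, ?_⟩
    have h2 := bdry_contr (gen_mul_stdVolume (k := k) (deg := deg)) partialD_stdVolume π 1
    rw [map_one, mul_one, h, divergence_one, mul_zero, sub_zero, map_zero] at h2
    exact h2

end Volume

/-! ### Units of bidegree zero. -/

section DegreeZero
variable {k : Type*} [Field k] {m n : ℕ}

variable (k m n) in
/-- The restriction of a polyvector on `k^{m||n}` to a function on `k^m`. -/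
def toPolynomial : Polyvector k (degA (m := m) (n := n)) →ₐ[k] MvPolynomial (Fin m) k :=
  BSym.lift (Sum.elim (Sum.elim MvPolynomial.X 0) 0) (by
    rintro ((i | i) | i) ((j | j) | j) <;> simp [polyDeg, degA, csign, mul_comm])

/-- The centre is a commutative target, which evaluation of polynomials at the `x_i` requires. -/
theorem mem_center_of_mem_comp_zero {G : Type*} {deg : G → Bideg} {x : BSym k deg}
    (hx : x ∈ comp k deg 0) : x ∈ Subalgebra.center k (BSym k deg) := by
  rw [Subalgebra.mem_center_iff]
  intro y
  induction y using homogeneous_induction with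
  | mem d y hy => rw [comp_commute hx hy, csign_zero_left, one_smul]
  | add y z hy hz => rw [add_mul, mul_add, hy, hz]

variable (k m n) in
/-- The polynomial functions on `k^m` as polyvectors on `k^{m||n}`. -/
def ofPolynomial : MvPolynomial (Fin m) k →ₐ[k]
    Subalgebra.center k (Polyvector k (degA (m := m) (n := n))) :=
  MvPolynomial.aeval fun i =>
    ⟨coord k degA (Sum.inl i), mem_center_of_mem_comp_zero (gen_mem_comp (Sum.inl (Sum.inl i)))⟩

/-- A word of bidegree zero involves only the `x_i`: weight zero excludes all vector fields, and
then parity counts the `y_j`. -/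
theorem ofPolynomial_toPolynomial {f : Polyvector k (degA (m := m) (n := n))}
    (hf : f ∈ comp k (polyDeg degA) 0) :
    (ofPolynomial k m n (toPolynomial k m n f) : Polyvector k (degA (m := m) (n := n))) = f := by
  induction hf using Submodule.span_induction with
  | mem f hf =>
    obtain ⟨l, hl, rfl⟩ := hf
    -- The inequalities are carried along so that a word of bidegree zero has a tail of bidegree
    -- zero.
    have key : (l.map (polyDeg degA)).sum.2 ≤ 0 ∧ ((l.map (polyDeg degA)).sum.2 = 0 →
        0 ≤ (l.map (polyDeg degA)).sum.1 ∧ ((l.map (polyDeg degA)).sum.1 = 0 →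
          (ofPolynomial k m n (toPolynomial k m n (l.map (gen k (polyDeg degA))).prod) :
            Polyvector k (degA (m := m) (n := n))) = (l.map (gen k (polyDeg degA))).prod)) := by
      clear hl
      induction l with
      | nil => simp
      | cons g l ih =>
        obtain ⟨h1, h2⟩ := ih
        simp only [List.map_cons, List.sum_cons, List.prod_cons, Prod.fst_add, Prod.snd_add,
          map_mul, Subalgebra.coe_mul]
        generalize (l.map (polyDeg degA)).sum = d at *
        rcases g with (i | i) | (i | i)
        · have e : toPolynomial k m n (gen k (polyDeg degA) (Sum.inl (Sum.inl i))) =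
              MvPolynomial.X i := by
            rw [toPolynomial, lift_gen]; rfl
          have e' : (ofPolynomial k m n (MvPolynomial.X i) :
              Polyvector k (degA (m := m) (n := n))) =
                gen k (polyDeg degA) (Sum.inl (Sum.inl i)) :=
            congrArg Subtype.val (MvPolynomial.aeval_X _ _)
          have ed : polyDeg (degA (m := m) (n := n)) (Sum.inl (Sum.inl i)) = (0, 0) := rfl
          rw [ed]
          simp only [zero_add]
          refine ⟨h1, fun h => ⟨(h2 h).1, fun h' => ?_⟩⟩
          rw [(h2 h).2 h', e, e']
        · have ed : polyDeg (degA (m := m) (n := n)) (Sum.inl (Sum.inr i)) = (1, 0) := rfl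
          rw [ed]
          simp only [zero_add]
          refine ⟨h1, fun h => ⟨by have := (h2 h).1; omega, fun h' => ?_⟩⟩
          have := (h2 h).1
          omega
        · have ed : polyDeg (degA (m := m) (n := n)) (Sum.inr (Sum.inl i)) = (0, -1) := rfl
          rw [ed]
          exact ⟨by simp only; omega, fun h => by simp only at h; omega⟩
        · have ed : polyDeg (degA (m := m) (n := n)) (Sum.inr (Sum.inr i)) = (-1, -1) := rfl
          rw [ed]
          exact ⟨by simp only; omega, fun h => by simp only at h; omega⟩
    refine (key.2 ?_).2 ?_ <;> rw [hl] <;> rfl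
  | zero => simp
  | add f g _ _ hf hg => rw [map_add, map_add, Subalgebra.coe_add, hf, hg]
  | smul c f _ hf => rw [map_smul, map_smul, Subalgebra.coe_smul, hf]

theorem exists_scalar_of_mul_eq_one {f g : Polyvector k (degA (m := m) (n := n))}
    (hf : f ∈ comp k (polyDeg degA) 0) (h : g * f = 1) : ∃ c : k, c ≠ 0 ∧ f = c • 1 := by
  have hu : IsUnit (toPolynomial k m n f) :=
    IsUnit.of_mul_eq_one (toPolynomial k m n g) (by rw [mul_comm, ← map_mul, h, map_one])
  obtain ⟨c, hc, e⟩ := MvPolynomial.isUnit_iff_eq_C_of_isReduced.1 hu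
  refine ⟨c, hc.ne_zero, ?_⟩
  rw [← ofPolynomial_toPolynomial hf, e, ← mul_one (MvPolynomial.C c), ← MvPolynomial.smul_eq_C_mul,
    map_smul, map_one]
  rfl

end DegreeZero

/-! ### The exchange isomorphism and the Koszul dual bivector. -/

section Exchange
variable {k : Type*} [Field k] {m n : ℕ}

variable (k m n) in
/-- The signs in the definition of `exchange`. -/
def exchangeSign : (Fin m ⊕ Fin n) ⊕ (Fin m ⊕ Fin n) → k :=
  Sum.elim 1 (Sum.elim (-1) 1)

theorem exchangeSign_sq (g : (Fin m ⊕ Fin n) ⊕ (Fin m ⊕ Fin n)) :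
    exchangeSign k m n g * exchangeSign k m n g = 1 := by
  rcases g with z | (i | j) <;> simp [exchangeSign]

theorem polyDeg_swap (g : (Fin m ⊕ Fin n) ⊕ (Fin m ⊕ Fin n)) :
    polyDeg degB g.swap = polyDeg degA g := by
  rcases g with (i | i) | (i | i) <;> simp [polyDeg, degA, degB]

theorem exchange_gen (g : (Fin m ⊕ Fin n) ⊕ (Fin m ⊕ Fin n)) :
    exchange k (gen k (polyDeg degA) g) = exchangeSign k m n g • gen k (polyDeg degB) g.swap := by
  rw [exchange, lift_gen]
  rcases g with z | (i | j) <;> simp [exchangeSign, vect, coord]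

theorem exchange_partialD (g : (Fin m ⊕ Fin n) ⊕ (Fin m ⊕ Fin n))
    (P : Polyvector k (degA (m := m) (n := n))) :
    partialD g.swap (exchange k P) = exchangeSign k m n g • exchange k (partialD g P) := by
  induction P using BSym.induction with
  | one => simp [partialD_one]
  | add P Q hP hQ => simp only [map_add, hP, hQ, smul_add]
  | smul c P hP => simp only [map_smul, hP, smul_comm c]
  | mul h P hP =>
    rw [map_mul, exchange_gen, smul_mul_assoc, map_smul, partialD_gen_mul, partialD_gen_mul, hP,
      map_add, map_smul, map_mul, exchange_gen, polyDeg_swap, polyDeg_swap]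
    by_cases e : h = g
    · subst e
      simp only [if_true, smul_mul_assoc, mul_smul_comm]
    · have e' : h.swap ≠ g.swap := fun h' => e (Sum.swap_leftInverse.injective h')
      simp only [if_neg e, if_neg e', map_zero, smul_mul_assoc, mul_smul_comm]
      match_scalars; ring

/-- Each coordinate swaps roles with its vector field, so every term of `Δ` goes to the
corresponding term with the derivatives in the other order. -/
theorem exchange_divergence (P : Polyvector k (degA (m := m) (n := n))) :
    divergence (exchange k P) = exchange k (divergence P) := by
  simp only [divergence_apply, map_neg, map_sum, map_smul]
  congr 1
  refine Finset.sum_congr rfl fun z _ => ?_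
  have h1 := exchange_partialD (k := k) (Sum.inl z) P
  have h2 := exchange_partialD (k := k) (Sum.inr z) (partialD (Sum.inl z) P)
  rw [Sum.swap_inl] at h1
  rw [Sum.swap_inr] at h2
  rw [h1, map_smul, h2, partialD_comm (Sum.inl z), map_smul, smul_smul, smul_smul, smul_smul]
  congr 1
  -- All weights are `-1` on the dual side. This sign is cancelled for `x_i` by the minus in
  -- `∂_{x_i} ↦ -ξ_i`, and for `y_j` by the anticommutation of the two derivatives.
  rcases z with i | j <;> simp [exchangeSign, degA, degB, polyDeg, csign]

variable (k m n) in
/-- The inverse of `exchange`. -/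
def exchangeInv : Polyvector k (degB (m := m) (n := n)) →ₐ[k]
    Polyvector k (degA (m := m) (n := n)) :=
  BSym.lift (fun g => exchangeSign k m n g.swap • gen k (polyDeg degA) g.swap) (by
    intro g h
    have e (g : (Fin m ⊕ Fin n) ⊕ (Fin m ⊕ Fin n)) : polyDeg degB g = polyDeg degA g.swap := by
      rw [← polyDeg_swap, Sum.swap_swap]
    rw [smul_mul_smul_comm, smul_mul_smul_comm, gen_mul_gen, e, e, smul_comm, mul_comm])

theorem exchangeInv_gen (g : (Fin m ⊕ Fin n) ⊕ (Fin m ⊕ Fin n)) :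
    exchangeInv k m n (gen k (polyDeg degB) g) =
      exchangeSign k m n g.swap • gen k (polyDeg degA) g.swap := lift_gen _ _ g

variable (k m n) in
/-- `exchange` as an isomorphism of algebras. -/
def exchangeEquiv :
    Polyvector k (degA (m := m) (n := n)) ≃ₐ[k] Polyvector k (degB (m := m) (n := n)) :=
  AlgEquiv.ofAlgHom (exchange k) (exchangeInv k m n)
    (algHom_ext fun g => by
      simp [exchangeInv_gen, exchange_gen, smul_smul, exchangeSign_sq])
    (algHom_ext fun g => by
      simp [exchangeInv_gen, exchange_gen, smul_smul, exchangeSign_sq])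

theorem exchangeEquiv_apply (P : Polyvector k (degA (m := m) (n := n))) :
    exchangeEquiv k m n P = exchange k P := rfl

theorem exchange_mem_comp {d : Bideg} {P : Polyvector k (degA (m := m) (n := n))}
    (hP : P ∈ comp k (polyDeg degA) d) : exchange k P ∈ comp k (polyDeg degB) d := by
  induction hP using Submodule.span_induction with
  | mem P hP =>
    obtain ⟨l, rfl, rfl⟩ := hP
    induction l with
    | nil => simp [one_mem_comp]
    | cons g l ih =>
      simp only [List.map_cons, List.sum_cons, List.prod_cons, map_mul, exchange_gen,
        smul_mul_assoc]
      exact Submodule.smul_mem _ _ (gen_mul_mem_comp _ ih (by rw [polyDeg_swap]))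
  | zero => simp
  | add P Q _ _ hP hQ => rw [map_add]; exact Submodule.add_mem _ hP hQ
  | smul c P _ hP => rw [map_smul]; exact Submodule.smul_mem _ _ hP

theorem exchange_proj (d : Bideg) (P : Polyvector k (degA (m := m) (n := n))) :
    exchange k (proj d P) = proj d (exchange k P) := by
  have h := proj_comm (k := k) 0 (exchange k (m := m) (n := n)).toLinearMap
    (fun d P hP => by rw [add_zero]; exact exchange_mem_comp hP) d P
  rwa [add_zero] at h

theorem exchangeEquiv_symm_mem_comp {d : Bideg} {Q : Polyvector k (degB (m := m) (n := n))}
    (hQ : Q ∈ comp k (polyDeg degB) d) :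
    (exchangeEquiv k m n).symm Q ∈ comp k (polyDeg degA) d := by
  obtain ⟨P, rfl⟩ := (exchangeEquiv k m n).surjective Q
  rw [AlgEquiv.symm_apply_apply]
  have h := proj_of_mem hQ d
  rw [if_pos rfl, exchangeEquiv_apply, ← exchange_proj] at h
  rw [← (exchangeEquiv k m n).injective h]
  exact proj_mem d P

theorem exchange_weightInv (P : Polyvector k (degA (m := m) (n := n))) :
    exchange k (weightInv P) = weightInv (exchange k P) := by
  induction P using homogeneous_induction with
  | mem d P hP => rw [twist_of_mem _ hP, twist_of_mem _ (exchange_mem_comp hP), map_smul]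
  | add P Q hP hQ => simp only [map_add, hP, hQ]

theorem exchange_bracket (P Q : Polyvector k (degA (m := m) (n := n))) :
    exchange k (bracket P Q) = bracket (exchange k P) (exchange k Q) := by
  simp only [bracket_eq, map_sub, map_mul, exchange_weightInv, ← exchange_divergence]

theorem exchange_cobdry (π P : Polyvector k (degA (m := m) (n := n))) :
    exchange k (cobdry π P) = cobdry (exchange k π) (exchange k P) :=
  exchange_bracket P π

/-- Let `p` be the number of odd coordinates among `i, j`; by `h` it is also that among `a, b`.
Moving the functions in front of the vector fields costs `(-1)^p`, and the minus signs of the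
exchange contribute `(-1)^{2-p}`. -/
theorem exchange_term {i j a b : Fin m ⊕ Fin n} (h : degA i + degA j = degA a + degA b) :
    exchange k (coord k degA i * coord k degA j * vect k degA a * vect k degA b) =
      coord k degB a * coord k degB b * vect k degB i * vect k degB j := by
  have e : (vect k degB i * vect k degB j) * (coord k degB a * coord k degB b) =
      csign k (polyDeg degA (Sum.inl i) + polyDeg degA (Sum.inl j))
        (polyDeg degA (Sum.inr a) + polyDeg degA (Sum.inr b)) •
      ((coord k degB a * coord k degB b) * (vect k degB i * vect k degB j)) := by
    simp only [← polyDeg_swap, Sum.swap_inl, Sum.swap_inr]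
    exact comp_commute (mul_mem_comp (gen_mem_comp _) (gen_mem_comp _))
      (mul_mem_comp (gen_mem_comp _) (gen_mem_comp _))
  have e' : exchange k (coord k degA i * coord k degA j * vect k degA a * vect k degA b) =
      (exchangeSign k m n (Sum.inr a) * exchangeSign k m n (Sum.inr b)) •
        ((vect k degB i * vect k degB j) * (coord k degB a * coord k degB b)) := by
    simp only [coord, vect, map_mul, exchange_gen, Sum.swap_inl, Sum.swap_inr]
    simp [exchangeSign, mul_assoc, smul_smul, mul_comm (Sum.elim _ _ b : k)]
  rw [e', e, smul_smul, ← mul_assoc]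
  rcases i with i | i <;> rcases j with j | j <;> rcases a with a | a <;> rcases b with b | b <;>
    simp [degA] at h <;> simp [exchangeSign, degA, polyDeg, csign]
  all_goals norm_num

theorem exchange_quadBivector
    {C : Fin m ⊕ Fin n → Fin m ⊕ Fin n → Fin m ⊕ Fin n → Fin m ⊕ Fin n → k}
    (hC : ∀ i j a b, C i j a b ≠ 0 → degA i + degA j = degA a + degA b) :
    exchange k (quadBivector k degA C) = quadBivector k degB (fun a b i j => C i j a b) := by
  have h (i j a b : Fin m ⊕ Fin n) :
      exchange k (C i j a b • (coord k degA i * coord k degA j * vect k degA a * vect k degA b)) =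
        C i j a b • (coord k degB a * coord k degB b * vect k degB i * vect k degB j) := by
    by_cases h : C i j a b = 0
    · rw [h, zero_smul, zero_smul, map_zero]
    · rw [map_smul, exchange_term (hC i j a b h)]
  simp only [quadBivector, map_sum, h]
  simp only [← Finset.sum_product', Finset.univ_product_univ]
  -- Reindexing by the swap of the pairs `(i, j)` and `(a, b)`.
  exact Fintype.sum_equiv ⟨fun x => (x.2.2.1, x.2.2.2, x.1, x.2.1),
    fun x => (x.2.2.1, x.2.2.2, x.1, x.2.1), fun _ => rfl, fun _ => rfl⟩ _ _ fun _ => rfl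

theorem quadBivector_mem_comp {Z : Type*} [Fintype Z] {deg : Z → Bideg} {C : Z → Z → Z → Z → k}
    (hC : ∀ i j a b, C i j a b ≠ 0 → deg i + deg j = deg a + deg b) :
    quadBivector k deg C ∈ comp k (polyDeg deg) (0, -2) := by
  refine Submodule.sum_mem _ fun i _ => Submodule.sum_mem _ fun j _ =>
    Submodule.sum_mem _ fun a _ => Submodule.sum_mem _ fun b _ => ?_
  by_cases h : C i j a b = 0
  · simp [h]
  · have e : ((0, -2) : Bideg) = polyDeg deg (Sum.inl i) + polyDeg deg (Sum.inl j) +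
        polyDeg deg (Sum.inr a) + polyDeg deg (Sum.inr b) := by
      rw [polyDeg_inl, polyDeg_inl, hC i j a b h, polyDeg_inr, polyDeg_inr]
      ext <;> simp; ring
    rw [e]
    exact Submodule.smul_mem _ _ (mul_mem_comp (mul_mem_comp (mul_mem_comp (gen_mem_comp _)
      (gen_mem_comp _)) (gen_mem_comp _)) (gen_mem_comp _))

end Exchange

/-! ### Maps induced on cohomology. -/

section Coh
variable {k : Type*} [Field k] {V W : Type*} [AddCommGroup V] [Module k V]
  [AddCommGroup W] [Module k W] {D : V →ₗ[k] V} {D' : W →ₗ[k] W}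

theorem cls_surjective (a : Coh D) : ∃ x : LinearMap.ker D, cls D x = a :=
  Submodule.Quotient.mk_surjective _ a

theorem cls_eq_zero {x : LinearMap.ker D} (h : (x : V) ∈ LinearMap.range D) : cls D x = 0 :=
  (Submodule.Quotient.mk_eq_zero _).2 h

theorem cls_add (x y : LinearMap.ker D) : cls D (x + y) = cls D x + cls D y := rfl

theorem cls_smul (c : k) (x : LinearMap.ker D) : cls D (c • x) = c • cls D x := rfl

theorem cls_congr {x y : LinearMap.ker D} (h : (x : V) = y) : cls D x = cls D y :=
  congrArg _ (Subtype.ext h)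

/-- The map induced on cohomology by a linear map that preserves cocycles and coboundaries. -/
def Coh.map (f : V →ₗ[k] W) (hk : ∀ x ∈ LinearMap.ker D, f x ∈ LinearMap.ker D')
    (hr : ∀ x ∈ LinearMap.range D, f x ∈ LinearMap.range D') : Coh D →ₗ[k] Coh D' :=
  Submodule.mapQ _ _ (f.restrict hk) fun x hx => hr x hx

theorem Coh.map_cls (f : V →ₗ[k] W) (hk : ∀ x ∈ LinearMap.ker D, f x ∈ LinearMap.ker D')
    (hr : ∀ x ∈ LinearMap.range D, f x ∈ LinearMap.range D') (x : LinearMap.ker D) :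
    Coh.map f hk hr (cls D x) = cls D' ⟨f x, hk x x.2⟩ := rfl

theorem Coh.induces_map (f : V →ₗ[k] W) (hk : ∀ x ∈ LinearMap.ker D, f x ∈ LinearMap.ker D')
    (hr : ∀ x ∈ LinearMap.range D, f x ∈ LinearMap.range D') :
    Induces D D' f (Coh.map f hk hr) := fun x => ⟨⟨f x, hk x x.2⟩, rfl, rfl⟩

/-- The isomorphism induced on cohomology by an isomorphism that identifies the cocycles and the
coboundaries. -/
def Coh.congr (f : V ≃ₗ[k] W) (hk : ∀ x, f x ∈ LinearMap.ker D' ↔ x ∈ LinearMap.ker D)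
    (hr : ∀ x, f x ∈ LinearMap.range D' ↔ x ∈ LinearMap.range D) : Coh D ≃ₗ[k] Coh D' :=
  LinearEquiv.ofLinearMap
    (Coh.map f.toLinearMap (fun x hx => (hk x).2 hx) (fun x hx => (hr x).2 hx))
    (Coh.map f.symm.toLinearMap (fun x hx => (hk _).1 (by simpa using hx))
      (fun x hx => (hr _).1 (by simpa using hx)))
    (LinearMap.ext fun a => by
      obtain ⟨x, rfl⟩ := cls_surjective a
      simp only [LinearMap.comp_apply, Coh.map_cls]
      exact cls_congr (f.apply_symm_apply _))
    (LinearMap.ext fun a => by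
      obtain ⟨x, rfl⟩ := cls_surjective a
      simp only [LinearMap.comp_apply, Coh.map_cls]
      exact cls_congr (f.symm_apply_apply _))

/-- The bilinear map induced on cohomology by a bilinear map that preserves cocycles and takes
coboundaries to coboundaries. -/
def Coh.map₂ (f : V →ₗ[k] V →ₗ[k] V)
    (hk : ∀ x ∈ LinearMap.ker D, ∀ y ∈ LinearMap.ker D, f x y ∈ LinearMap.ker D)
    (hl : ∀ x ∈ LinearMap.range D, ∀ y ∈ LinearMap.ker D, f x y ∈ LinearMap.range D)
    (hr : ∀ x ∈ LinearMap.ker D, ∀ y ∈ LinearMap.range D, f x y ∈ LinearMap.range D) :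
    Coh D →ₗ[k] Coh D →ₗ[k] Coh D :=
  -- The second argument is placed first and factored through the quotient; after the flip the same
  -- is done for the first.
  Submodule.liftQ _ (Submodule.liftQ _ (LinearMap.mk₂ k
      (fun y x : LinearMap.ker D => cls D ⟨f x y, hk x x.2 y y.2⟩)
      (fun y y' x => by rw [← cls_add]; exact cls_congr (map_add (f x) _ _))
      (fun c y x => by rw [← cls_smul]; exact cls_congr (map_smul (f x) _ _))
      (fun y x x' => by rw [← cls_add]; exact cls_congr (LinearMap.map_add₂ f _ _ _))
      (fun c y x => by rw [← cls_smul]; exact cls_congr (LinearMap.map_smul₂ f _ _ _)))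
    (fun y hy => LinearMap.ext fun x => cls_eq_zero (hr x x.2 y hy))).flip
    (fun x hx => LinearMap.ext fun a => by
      obtain ⟨y, rfl⟩ := cls_surjective a
      exact cls_eq_zero (hl x hx y y.2))

theorem Coh.mem_part {S : Submodule k V} {a : Coh D} :
    a ∈ Coh.part D S ↔ ∃ x : LinearMap.ker D, (x : V) ∈ S ∧ cls D x = a := Iff.rfl

end Coh

/-! ### The bigrading on cohomology. -/

section Grading
variable {k : Type*} [Field k] {G : Type*} {deg : G → Bideg}

/-- The cohomology of a homogeneous endomorphism of `BSym` is bi-graded. -/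
theorem isInternal_part (D : BSym k deg →ₗ[k] BSym k deg) (e : Bideg)
    (hD : ∀ d, ∀ x ∈ comp k deg d, D x ∈ comp k deg (d + e)) :
    DirectSum.IsInternal fun d => Coh.part D (comp k deg d) := by
  have hk (d : Bideg) : ∀ x ∈ LinearMap.ker D, proj d x ∈ LinearMap.ker D := by
    intro x hx
    rw [LinearMap.mem_ker] at hx ⊢
    rw [proj_comm e D hD, hx, map_zero]
  have hr (d : Bideg) : ∀ x ∈ LinearMap.range D, proj d x ∈ LinearMap.range D := by
    rintro _ ⟨x, rfl⟩
    refine ⟨proj (d - e) x, ?_⟩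
    rw [proj_comm e D hD, sub_add_cancel]
  rw [DirectSum.isInternal_submodule_iff_iSupIndep_and_iSup_eq_top]
  constructor
  · intro d
    rw [Submodule.disjoint_def]
    intro a ha ha'
    obtain ⟨x, hx, rfl⟩ := Coh.mem_part.1 ha
    -- The projection to bidegree `d` acts on cohomology as the identity on the part `d` and as zero
    -- on all others, which gives independence.
    have h1 : Coh.map (proj d) (hk d) (hr d) (cls D x) = cls D x := by
      rw [Coh.map_cls]
      exact cls_congr ((proj_of_mem hx d).trans (if_pos rfl))
    rw [← h1]
    have h2 : ⨆ e', ⨆ (_ : e' ≠ d), Coh.part D (comp k deg e') ≤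
        LinearMap.ker (Coh.map (proj d) (hk d) (hr d)) := by
      refine iSup₂_le fun e' he' b hb => ?_
      obtain ⟨y, hy, rfl⟩ := Coh.mem_part.1 hb
      rw [LinearMap.mem_ker, Coh.map_cls]
      apply cls_eq_zero
      simp only [proj_of_mem hy, if_neg he'.symm, Submodule.zero_mem]
    exact h2 ha'
  · rw [eq_top_iff]
    rintro a -
    obtain ⟨x, rfl⟩ := cls_surjective a
    obtain ⟨s, hs⟩ := exists_sum_proj (x : BSym k deg)
    have h : x = ∑ d ∈ s, ⟨proj d x, hk d x x.2⟩ := by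
      apply Subtype.ext
      rw [Submodule.coe_sum]
      exact hs
    have h' : cls D x = ∑ d ∈ s, cls D ⟨proj d x, hk d x x.2⟩ := by
      conv_lhs => rw [h]
      exact map_sum ((LinearMap.range D).submoduleOf (LinearMap.ker D)).mkQ _ _
    rw [h']
    refine Submodule.sum_mem _ fun d _ => Submodule.mem_iSup_of_mem d ?_
    exact Coh.mem_part.2 ⟨_, proj_mem d _, rfl⟩

end Grading

/-! ### The Batalin-Vilkovisky structure on Poisson cohomology. -/

section PoissonBV
variable {k : Type*} [Field k] [CharZero k] {Z : Type*} [Fintype Z] [DecidableEq Z]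
  {deg : Z → Bideg} {π : Polyvector k deg}

/-- The product on the Poisson cohomology. -/
def cohMul (hπ : π ∈ comp k (polyDeg deg) (0, -2)) (hΔ : divergence π = 0) :
    HP π →ₗ[k] HP π →ₗ[k] HP π :=
  Coh.map₂ (LinearMap.mul k _)
    (fun x hx y hy => by
      rw [LinearMap.mem_ker] at hx hy ⊢
      rw [LinearMap.mul_apply', cobdry_mul hπ hΔ, hx, hy, zero_mul, mul_zero, add_zero])
    (by
      rintro _ ⟨x, rfl⟩ y hy
      rw [LinearMap.mem_ker] at hy
      -- The involution on `y` undoes the one that the Leibniz rule puts on the right factor.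
      refine ⟨x * weightInv y, ?_⟩
      rw [cobdry_mul hπ hΔ, twist_twist, cobdry_weightInv hπ hΔ, hy, map_zero, neg_zero, mul_zero,
        add_zero, LinearMap.mul_apply'])
    (by
      rintro x hx _ ⟨y, rfl⟩
      rw [LinearMap.mem_ker] at hx
      refine ⟨x * y, ?_⟩
      rw [cobdry_mul hπ hΔ, hx, zero_mul, zero_add, LinearMap.mul_apply'])

/-- The operator on the Poisson cohomology that is induced by the divergence. -/
def cohDivergence (hπ : π ∈ comp k (polyDeg deg) (0, -2)) (hΔ : divergence π = 0) :
    HP π →ₗ[k] HP π :=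
  Coh.map divergence
    (fun x hx => by
      rw [LinearMap.mem_ker] at hx ⊢
      rw [cobdry_divergence hπ hΔ, hx, map_zero])
    (by
      rintro _ ⟨x, rfl⟩
      exact ⟨divergence x, cobdry_divergence hπ hΔ x⟩)

/-- The grading involution on the Poisson cohomology. -/
def cohWeightInv (hπ : π ∈ comp k (polyDeg deg) (0, -2)) (hΔ : divergence π = 0) :
    HP π →ₗ[k] HP π :=
  Coh.map weightInv.toLinearMap
    (fun x hx => by
      rw [LinearMap.mem_ker] at hx ⊢
      rw [AlgHom.toLinearMap_apply, cobdry_weightInv hπ hΔ, hx, map_zero, neg_zero])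
    (by
      rintro _ ⟨x, rfl⟩
      refine ⟨-weightInv x, ?_⟩
      rw [map_neg, cobdry_weightInv hπ hΔ, neg_neg, AlgHom.toLinearMap_apply])

/-- The Batalin-Vilkovisky structure on the Poisson cohomology of a divergence-free bivector. -/
def poissonBV (hπ : π ∈ comp k (polyDeg deg) (0, -2)) (hΔ : divergence π = 0) :
    BVAlgebra k (HP π) (HPcomp π) where
  one := cls (cobdry π) ⟨1, cobdry_one hπ hΔ⟩
  mul := cohMul hπ hΔ
  Δ := cohDivergence hπ hΔ
  isInternal := isInternal_part (cobdry π) (0, -1) fun _ _ h => cobdry_mem_comp hπ hΔ h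
  one_mem := Coh.mem_part.2 ⟨⟨1, cobdry_one hπ hΔ⟩, one_mem_comp, rfl⟩
  mul_mem := by
    intro d e a ha b hb
    obtain ⟨x, hx, rfl⟩ := Coh.mem_part.1 ha
    obtain ⟨y, hy, rfl⟩ := Coh.mem_part.1 hb
    exact Coh.mem_part.2 ⟨_, mul_mem_comp hx hy, rfl⟩
  one_mul := by
    intro a
    obtain ⟨x, rfl⟩ := cls_surjective a
    exact cls_congr (one_mul _)
  mul_assoc := by
    intro a b c
    obtain ⟨x, rfl⟩ := cls_surjective a
    obtain ⟨y, rfl⟩ := cls_surjective b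
    obtain ⟨z, rfl⟩ := cls_surjective c
    exact cls_congr (mul_assoc _ _ _)
  mul_comm := by
    intro d e a ha b hb
    obtain ⟨x, hx, rfl⟩ := Coh.mem_part.1 ha
    obtain ⟨y, hy, rfl⟩ := Coh.mem_part.1 hb
    exact cls_congr (comp_commute hx hy)
  Δ_mem := by
    intro d a ha
    obtain ⟨x, hx, rfl⟩ := Coh.mem_part.1 ha
    exact Coh.mem_part.2 ⟨_, divergence_mem_comp hx, rfl⟩
  Δ_sq := by
    intro a
    obtain ⟨x, rfl⟩ := cls_surjective a
    exact cls_congr (divergence_divergence _)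
  Δ_second_order := by
    intro d e a ha b hb c
    obtain ⟨x, hx, rfl⟩ := Coh.mem_part.1 ha
    obtain ⟨y, hy, rfl⟩ := Coh.mem_part.1 hb
    obtain ⟨z, rfl⟩ := cls_surjective c
    exact cls_congr (divergence_mul_mul hx hy _)

end PoissonBV

/-! ### Poincaré duality and the induced bracket. -/

section Duality
variable {k : Type*} [Field k] [CharZero k] {m n : ℕ}
  {deg : Fin m ⊕ Fin n → Bideg} {π : Polyvector k deg}

/-- Poincaré duality between the Poisson cohomology and the mixed Poisson homology. -/
def poincareDuality (hπ : π ∈ comp k (polyDeg deg) (0, -2)) (hΔ : divergence π = 0) :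
    HP π ≃ₗ[k] MixedHP π :=
  -- Contraction intertwines the two differentials only up to the invertible involution `(-1)^w` and
  -- a sign, which is enough to match kernels and images.
  have h (P : Polyvector k deg) : bdry π (contrVolume k deg P) =
      -contrVolume k deg (weightInv (cobdry π P)) := by
    rw [bdry_contrVolume hπ hΔ, ← twist_twist (0, 1) P, ← cobdry_eq hπ hΔ, cobdry_weightInv hπ hΔ,
      map_neg, twist_twist]
  have inj : Function.Injective (weightInv (k := k) (deg := deg)) :=
    Function.LeftInverse.injective (twist_twist (0, 1))
  Coh.congr (contrVolume k deg)
    (fun P => by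
      rw [LinearMap.mem_ker, LinearMap.mem_ker, h, neg_eq_zero, LinearEquiv.map_eq_zero_iff,
        map_eq_zero_iff _ inj])
    (fun P => by
      constructor
      · rintro ⟨ω, hω⟩
        obtain ⟨Q, rfl⟩ := (contrVolume k deg).surjective ω
        rw [h, ← map_neg] at hω
        refine ⟨weightInv Q, ?_⟩
        rw [cobdry_weightInv hπ hΔ]
        exact (contrVolume k deg).injective hω
      · rintro ⟨Q, rfl⟩
        refine ⟨contrVolume k deg (weightInv Q), ?_⟩
        rw [h, cobdry_weightInv hπ hΔ, map_neg, map_neg, neg_neg, twist_twist])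

theorem isPoissonBV_poissonBV (hπ : π ∈ comp k (polyDeg deg) (0, -2)) (hΔ : divergence π = 0) :
    IsPoissonBV π (stdVolume k deg) (poissonBV hπ hΔ) where
  one := ⟨_, rfl, rfl⟩
  mul := fun x y => ⟨_, rfl, rfl⟩
  delta := by
    refine ⟨poincareDuality hπ hΔ, Coh.map mixD ?_ ?_, fun x => ⟨_, rfl, rfl⟩,
      Coh.induces_map _ _ _, ?_⟩
    · intro ω hω
      rw [LinearMap.mem_ker] at hω ⊢
      rw [bdry_mixD, hω, map_zero, neg_zero]
    · rintro _ ⟨ω, rfl⟩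
      exact ⟨-mixD ω, by rw [map_neg, bdry_mixD, neg_neg]⟩
    · intro a
      rw [← map_neg, eq_comm, LinearEquiv.symm_apply_eq]
      obtain ⟨x, rfl⟩ := cls_surjective a
      have e : -mixD (contrVolume k deg x) = contrVolume k deg (divergence x) := by
        rw [mixD_contrVolume, neg_neg]
      exact cls_congr e
  bracket := by
    -- The bracket on cohomology is defined by the formula of `bracket_eq`; the induced involution
    -- makes it bilinear without splitting into components.
    refine ⟨(cohMul hπ hΔ).compr₂ (cohDivergence hπ hΔ) ∘ₗ cohWeightInv hπ hΔ -
      cohMul hπ hΔ ∘ₗ cohDivergence hπ hΔ ∘ₗ cohWeightInv hπ hΔ -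
      (cohMul hπ hΔ).compl₂ (cohDivergence hπ hΔ), fun x y => ?_, ?_⟩
    · have h : Bigraded.bracket (x : Polyvector k deg) y ∈ LinearMap.ker (cobdry π) := by
        have hx := LinearMap.mem_ker.1 x.2
        have hy := LinearMap.mem_ker.1 y.2
        rw [LinearMap.mem_ker, bracket_eq]
        simp only [map_sub, cobdry_divergence hπ hΔ, cobdry_mul hπ hΔ, cobdry_weightInv hπ hΔ,
          divergence_weightInv, map_neg, hx, hy, map_zero, mul_zero, zero_mul, neg_zero, add_zero,
          sub_zero]
      exact ⟨⟨_, h⟩, rfl, cls_congr (bracket_eq _ _).symm⟩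
    · intro d a ha b
      obtain ⟨x, hx, rfl⟩ := Coh.mem_part.1 ha
      have e : cohWeightInv hπ hΔ (cls (cobdry π) x) = csign k (0, 1) d • cls (cobdry π) x :=
        cls_congr (twist_of_mem _ hx)
      simp [e, poissonBV]

end Duality

/-! ### Transport along the exchange isomorphism. -/

section Main
variable {k : Type*} [Field k] [CharZero k] {m n : ℕ}

/-- The isomorphism of Batalin-Vilkovisky algebras induced by `exchange`. -/
def exchangeBVIso {π : Polyvector k (degA (m := m) (n := n))}
    {π' : Polyvector k (degB (m := m) (n := n))} (h : exchange k π = π')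
    (hπ : π ∈ comp k (polyDeg degA) (0, -2)) (hΔ : divergence π = 0)
    (hπ' : π' ∈ comp k (polyDeg degB) (0, -2)) (hΔ' : divergence π' = 0) :
    BVIso (poissonBV hπ hΔ) (poissonBV hπ' hΔ') where
  __ := Coh.congr (exchangeEquiv k m n).toLinearEquiv
    (fun P => by
      rw [LinearMap.mem_ker, LinearMap.mem_ker, ← h]
      change cobdry (exchange k π) (exchange k P) = 0 ↔ _
      rw [← exchange_cobdry]
      exact (exchangeEquiv k m n).toLinearEquiv.map_eq_zero_iff)
    (fun P => by
      subst h
      constructor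
      · rintro ⟨Q, hQ⟩
        obtain ⟨R, rfl⟩ := (exchangeEquiv k m n).surjective Q
        refine ⟨R, (exchangeEquiv k m n).injective ?_⟩
        exact (exchange_cobdry π R).trans hQ
      · rintro ⟨Q, rfl⟩
        exact ⟨exchange k Q, (exchange_cobdry π Q).symm⟩)
  map_comp := by
    intro d
    ext b
    rw [Submodule.mem_map]
    constructor
    · rintro ⟨a, ha, rfl⟩
      obtain ⟨x, hx, rfl⟩ := Coh.mem_part.1 ha
      exact Coh.mem_part.2 ⟨_, exchange_mem_comp hx, rfl⟩
    · intro hb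
      obtain ⟨y, hy, rfl⟩ := Coh.mem_part.1 hb
      have e : exchange k ((exchangeEquiv k m n).symm y) = y :=
        (exchangeEquiv k m n).apply_symm_apply y
      have hx : (exchangeEquiv k m n).symm y ∈ LinearMap.ker (cobdry π) := by
        apply (exchangeEquiv k m n).injective
        rw [exchangeEquiv_apply, exchange_cobdry, h, e, map_zero]
        exact y.2
      exact ⟨cls _ ⟨_, hx⟩, Coh.mem_part.2 ⟨_, exchangeEquiv_symm_mem_comp hy, rfl⟩, cls_congr e⟩
  map_one := cls_congr (map_one (exchange k))
  map_mul := by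
    intro a b
    obtain ⟨x, rfl⟩ := cls_surjective a
    obtain ⟨y, rfl⟩ := cls_surjective b
    exact cls_congr (map_mul (exchange k) _ _)
  map_Δ := by
    intro a
    obtain ⟨x, rfl⟩ := cls_surjective a
    exact cls_congr (exchange_divergence _).symm

theorem isUnimodular_degA_iff {π : Polyvector k (degA (m := m) (n := n))} :
    IsUnimodular π ↔ divergence π = 0 :=
  isUnimodular_iff (fun i => by simp [mixDeg, baseDeg, degA])
    (fun j => by simp [mixDeg, baseDeg, degA])
    fun _ hf _ _ h => exists_scalar_of_mul_eq_one hf h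

/-- The exchange preserves bidegrees, so units of bidegree zero on the dual side are pulled back to
polynomial units and are again constants. -/
theorem isUnimodular_degB_iff {π : Polyvector k (degB (m := m) (n := n))} :
    IsUnimodular π ↔ divergence π = 0 := by
  refine isUnimodular_iff (fun i => by simp [mixDeg, baseDeg, degB])
    (fun j => by simp [mixDeg, baseDeg, degB]) fun f hf g _ h => ?_
  obtain ⟨c, hc, e⟩ := exists_scalar_of_mul_eq_one (exchangeEquiv_symm_mem_comp hf)
    (g := (exchangeEquiv k m n).symm g) (by rw [← map_mul, h, map_one])
  exact ⟨c, hc, (exchangeEquiv k m n).symm.injective (by rw [e, map_smul, map_one])⟩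

end Main
end Bigraded
end

theorem mainTheorem10 {k : Type*} [Field k] [CharZero k] (m n : ℕ)
    (C : Fin m ⊕ Fin n → Fin m ⊕ Fin n → Fin m ⊕ Fin n → Fin m ⊕ Fin n → k)
    (hC : ∀ i j a b, C i j a b ≠ 0 →
      Bigraded.degA i + Bigraded.degA j = Bigraded.degA a + Bigraded.degA b)
    (π : Bigraded.Polyvector k (Bigraded.degA (m := m) (n := n)))
    (hπ : π = Bigraded.quadBivector k Bigraded.degA C)
    (π' : Bigraded.Polyvector k (Bigraded.degB (m := m) (n := n)))
    (hπ' : π' = Bigraded.quadBivector k Bigraded.degB (fun a b i j => C i j a b))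
    (hPoisson : Bigraded.IsPoisson π) :
    Bigraded.IsPoisson π' ∧
    (Bigraded.IsUnimodular π ↔ Bigraded.IsUnimodular π') ∧
    (Bigraded.IsUnimodular π →
      ∃ (B : Bigraded.BVAlgebra k (Bigraded.HP π) (Bigraded.HPcomp π))
        (B' : Bigraded.BVAlgebra k (Bigraded.HP π') (Bigraded.HPcomp π'))
        (e : Bigraded.BVIso B B'),
        Bigraded.IsPoissonBV π (Bigraded.stdVolume k Bigraded.degA) B ∧
        Bigraded.IsPoissonBV π' (Bigraded.stdVolume k Bigraded.degB) B' ∧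
        Bigraded.Induces (Bigraded.cobdry π) (Bigraded.cobdry π') (Bigraded.exchange k)
          (fun a => e.toLinearEquiv a)) := by
  have hE : Bigraded.exchange k π = π' := by
    rw [hπ, hπ', Bigraded.exchange_quadBivector hC]
  have hdeg : π ∈ Bigraded.BSym.comp k (Bigraded.polyDeg Bigraded.degA) (0, -2) :=
    hπ ▸ Bigraded.quadBivector_mem_comp hC
  have hdeg' : π' ∈ Bigraded.BSym.comp k (Bigraded.polyDeg Bigraded.degB) (0, -2) :=
    hE ▸ Bigraded.exchange_mem_comp hdeg
  have hΔ : Bigraded.divergence π = 0 ↔ Bigraded.divergence π' = 0 := by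
    rw [← hE, Bigraded.exchange_divergence]
    exact ((Bigraded.exchangeEquiv k m n).toLinearEquiv.map_eq_zero_iff).symm
  refine ⟨?_, ?_, fun h => ?_⟩
  · rw [Bigraded.IsPoisson, ← hE, ← Bigraded.exchange_bracket, hPoisson, map_zero]
  · rw [Bigraded.isUnimodular_degA_iff, Bigraded.isUnimodular_degB_iff, hΔ]
  · have h1 := Bigraded.isUnimodular_degA_iff.1 h
    exact ⟨Bigraded.poissonBV hdeg h1, Bigraded.poissonBV hdeg' (hΔ.1 h1),
      Bigraded.exchangeBVIso hE hdeg h1 hdeg' (hΔ.1 h1),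
      Bigraded.isPoissonBV_poissonBV hdeg h1, Bigraded.isPoissonBV_poissonBV hdeg' (hΔ.1 h1),
      fun x => ⟨_, rfl, rfl⟩⟩
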